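/- **Conventions.** Let $G\rightrightarrows M$ be a Lie groupoid (finite-dimensional smooth manifolds without boundary; source $s$ and target $t$ submersions; the other structure maps smooth). A *$G$-path* of order $n\ge 0$ from $x$ to $y$ is a sequence $\sigma=\sigma_n g_n\sigma_{n-1}\cdots\sigma_1 g_1\sigma_0$ of piecewise smooth paths $\sigma_j:[0,1]\to M$ and arrows $g_j:\sigma_{j-1}(1)\to\sigma_j(0)$ of $G$ with $\sigma_0(0)=x$, $\sigma_n(1)=y$; it is a *$G$-loop* at $x$ if $x=y$. $G$ is *$G$-connected* if any two points of $M$ are joined by a $G$-path. Two $G$-paths from $x$ to $y$ are *$G$-homotopic* if one can be transformed into the other by finitely many of the following moves and their inverses: (i) replace $g_{j+1}\sigma_j g_j$ by the product $g_{j+1}g_j$, where $\sigma_j$ is a constant path and $0<j<n$; (ii) replace $\sigma_j g_j\sigma_{j-1}$ by the concatenated path $\sigma_j\cdot\sigma_{j-1}$ (first $\sigma_{j-1}$), where $g_j$ is a unit arrow and $0<j\le n$; (iii) replace $\sigma$ by $\sigma'$ of the same order $n$ if there are homotopies $D_j:[0,1]^2\to M$ from $\sigma_j$ to $\sigma'_j$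 ($0\le j\le n$) and paths $d_j:[0,1]\to G$ from $g_j$ to $g'_j$ ($1\le j\le n$) with $s\circ d_j=D_{j-1}(\cdot,1)$, $t\circ d_j=D_j(\cdot,0)$, $D_0(\cdot,0)=x$ and $D_n(\cdot,1)=y$. The *fundamental group* $\Pi_1(G,x_0)$ is the group of $G$-homotopy classes of $G$-loops at $x_0$, with product $[\sigma][\sigma']=[\sigma*\sigma']$, $\sigma*\sigma'=\sigma'_m g'_m\cdots\sigma'_0\,1_{x_0}\,\sigma_n g_n\cdots\sigma_0$. Let $G^{(0)}=M$ and $G^{(n)}=\{(g_1,\dots,g_n): s(g_j)=t(g_{j+1})\}$ be the nerve, with face maps $d_0=t$, $d_1=s$ on $G^{(1)}=G$, and, for $n\ge 2$, $d_0$ and $d_n$ dropping $g_1$ resp. $g_n$ and $d_k$ replacing $g_k,g_{k+1}$ by $g_kg_{k+1}$ for $0<k<n$. Let $C_q(G^{(n)})$ be the group of singular $q$-chains of $G^{(n)}$, $d=\sum_j(-1)^jd_j$ the singular boundary and $\partial=\sum_k(-1)^k(d_k)_*$ the simplicial one (zero for $n=0$). The *total singular homology* $H_\bullet(G,\mathbb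 Z)$ is the homology of $\tilde C_v(G)=\bigoplus_{q+n=v}C_q(G^{(n)})$ with differential $\delta\gamma=(-1)^{q+n}\partial\gamma+(-1)^q d\gamma$ for $\gamma\in C_q(G^{(n)})$. For a $G$-loop $\sigma=\sigma_n g_n\cdots g_1\sigma_0$ the chain $\sum_{j=0}^n\sigma_j+\sum_{j=1}^n g_j\in C_1(M)\oplus C_0(G)=\tilde C_1(G)$ is a cycle; let $|\sigma|\in H_1(G,\mathbb Z)$ be its class. **Proposition (Hurewicz $G$-homomorphism).** Let $G\rightrightarrows M$ be a $G$-connected Lie groupoid and $x_0\in M$. Then $h:\Pi_1(G,x_0)\to H_1(G,\mathbb Z)$, $h([\sigma])=|\sigma|$, is a well-defined group homomorphism, and the homomorphism $$\Pi_1(G,x_0)/[\Pi_1(G,x_0),\Pi_1(G,x_0)]\longrightarrow H_1(G,\mathbb Z)$$ induced by $h$ is an isomorphism. -/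

import Mathlib

open scoped Manifold ContDiff

universe u

noncomputable section

/-! ### Lie groupoids -/

/-- A Lie groupoid with manifold of objects `M` (modelled on `EM`) and manifold of arrows `G`
(modelled on `EG`). `comp g h` is the arrow "first `h`, then `g`"; it is only meaningful
if `s g = t h`. The set of composable pairs is an embedded submanifold of `G × G`, so that
smoothness of the multiplication is smoothness of `comp` on that set. -/
structure LieGroupoid (EM EG M G : Type*)
    [NormedAddCommGroup EM] [NormedSpace ℝ EM] [NormedAddCommGroup EG] [NormedSpace ℝ EG]
    [TopologicalSpace M] [ChartedSpace EM M] [TopologicalSpace G] [ChartedSpace EG G] where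
  /-- source -/
  s : G → M
  /-- target -/
  t : G → M
  /-- multiplication -/
  comp : G → G → G
  /-- units -/
  unit : M → G
  /-- inversion -/
  inv : G → G
  s_unit : ∀ x, s (unit x) = x
  t_unit : ∀ x, t (unit x) = x
  s_comp : ∀ g h, s g = t h → s (comp g h) = s h
  t_comp : ∀ g h, s g = t h → t (comp g h) = t g
  assoc : ∀ g h k, s g = t h → s h = t k → comp (comp g h) k = comp g (comp h k)
  unit_comp : ∀ g, comp (unit (t g)) g = g
  comp_unit : ∀ g, comp g (unit (s g)) = g
  s_inv : ∀ g, s (inv g) = t g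
  t_inv : ∀ g, t (inv g) = s g
  inv_comp : ∀ g, comp (inv g) g = unit (s g)
  comp_inv : ∀ g, comp g (inv g) = unit (t g)
  s_submersion : Manifold.IsSubmersion 𝓘(ℝ, EG) 𝓘(ℝ, EM) ∞ s
  t_submersion : Manifold.IsSubmersion 𝓘(ℝ, EG) 𝓘(ℝ, EM) ∞ t
  smooth_unit : ContMDiff 𝓘(ℝ, EM) 𝓘(ℝ, EG) ∞ unit
  smooth_inv : ContMDiff 𝓘(ℝ, EG) 𝓘(ℝ, EG) ∞ inv
  smooth_comp : ContMDiffOn (𝓘(ℝ, EG).prod 𝓘(ℝ, EG)) 𝓘(ℝ, EG) ∞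
    (fun p : G × G => comp p.1 p.2) {p : G × G | s p.1 = t p.2}

/-! ### Piecewise smooth paths -/

/-- A continuous path is piecewise smooth if, away from a finite set of break points, it is smooth
on every closed subinterval (up to the end points of the subinterval) without break points in
its interior. -/
def IsPiecewiseSmooth (E : Type*) [NormedAddCommGroup E] [NormedSpace ℝ E]
    {M : Type*} [TopologicalSpace M] [ChartedSpace E M] {x y : M} (γ : Path x y) : Prop :=
  ∃ S : Finset ℝ, ∀ a b : ℝ, 0 ≤ a → a < b → b ≤ 1 → (∀ c ∈ S, c ∉ Set.Ioo a b) →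
    ContMDiffOn 𝓘(ℝ, ℝ) 𝓘(ℝ, E) ∞ γ.extend (Set.Icc a b)

section PiecewiseSmooth

variable {E : Type*} [NormedAddCommGroup E] [NormedSpace ℝ E]
  {M : Type*} [TopologicalSpace M] [ChartedSpace E M]

theorem IsPiecewiseSmooth.refl (x : M) : IsPiecewiseSmooth E (Path.refl x) := by
  refine ⟨∅, fun a b _ _ _ _ => ?_⟩
  rw [Path.refl_extend]
  exact contMDiffOn_const

theorem IsPiecewiseSmooth.symm {x y : M} {γ : Path x y} (h : IsPiecewiseSmooth E γ) :
    IsPiecewiseSmooth E γ.symm := by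
  obtain ⟨S, hS⟩ := h
  refine ⟨S.image (fun c => 1 - c), fun a b ha hab hb hc => ?_⟩
  rw [Path.extend_symm]
  have h1 := hS (1 - b) (1 - a) (by linarith) (by linarith) (by linarith) (fun c hcS hcI => by
    refine hc (1 - c) (Finset.mem_image_of_mem _ hcS) ⟨?_, ?_⟩ <;> linarith [hcI.1, hcI.2])
  refine h1.comp (t := Set.Icc (1 - b) (1 - a)) (f := fun r : ℝ => 1 - r) ?_ ?_
  · exact (contDiff_const.sub contDiff_id).contMDiff.contMDiffOn
  · intro r hr
    exact ⟨by linarith [hr.2], by linarith [hr.1]⟩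

theorem IsPiecewiseSmooth.trans {x y z : M} {γ : Path x y} {γ' : Path y z}
    (h : IsPiecewiseSmooth E γ) (h' : IsPiecewiseSmooth E γ') :
    IsPiecewiseSmooth E (γ.trans γ') := by
  obtain ⟨S, hS⟩ := h
  obtain ⟨S', hS'⟩ := h'
  refine ⟨insert (1 / 2) (S.image (fun c => c / 2) ∪ S'.image (fun c => (c + 1) / 2)),
    fun a b ha hab hb hc => ?_⟩
  have hhalf : b ≤ 1 / 2 ∨ 1 / 2 ≤ a := by
    by_contra hcon
    push Not at hcon
    exact hc _ (Finset.mem_insert_self _ _) ⟨hcon.2, hcon.1⟩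
  rcases hhalf with hb2 | ha2
  · have h1 := hS (2 * a) (2 * b) (by linarith) (by linarith) (by linarith) (fun c hcS hcI => by
      refine hc (c / 2) (Finset.mem_insert_of_mem (Finset.mem_union_left _
        (Finset.mem_image_of_mem _ hcS))) ⟨?_, ?_⟩ <;> linarith [hcI.1, hcI.2])
    have h2 : ContMDiffOn 𝓘(ℝ, ℝ) 𝓘(ℝ, E) ∞ (γ.extend ∘ fun r : ℝ => 2 * r) (Set.Icc a b) := by
      refine h1.comp (t := Set.Icc (2 * a) (2 * b)) (f := fun r : ℝ => 2 * r) ?_ ?_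
      · exact (contDiff_const.mul contDiff_id).contMDiff.contMDiffOn
      · intro r hr
        exact ⟨by linarith [hr.1], by linarith [hr.2]⟩
    refine h2.congr fun r hr => ?_
    rw [Path.extend_trans_of_le_half _ _ (hr.2.trans hb2)]
    rfl
  · have h1 := hS' (2 * a - 1) (2 * b - 1) (by linarith) (by linarith) (by linarith)
      (fun c hcS hcI => by
        refine hc ((c + 1) / 2) (Finset.mem_insert_of_mem (Finset.mem_union_right _
          (Finset.mem_image_of_mem _ hcS))) ⟨?_, ?_⟩ <;> linarith [hcI.1, hcI.2])
    have h2 : ContMDiffOn 𝓘(ℝ, ℝ) 𝓘(ℝ, E) ∞ (γ'.extend ∘ fun r : ℝ => 2 * r - 1)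
        (Set.Icc a b) := by
      refine h1.comp (t := Set.Icc (2 * a - 1) (2 * b - 1)) (f := fun r : ℝ => 2 * r - 1) ?_ ?_
      · exact ((contDiff_const.mul contDiff_id).sub contDiff_const).contMDiff.contMDiffOn
      · intro r hr
        exact ⟨by linarith [hr.1], by linarith [hr.2]⟩
    refine h2.congr fun r hr => ?_
    rw [Path.extend_trans_of_half_le _ _ (ha2.trans hr.1)]
    rfl

end PiecewiseSmooth

/-- Piecewise smooth paths `[0,1] → M` from `x` to `y`. -/
def PSPath (E : Type*) [NormedAddCommGroup E] [NormedSpace ℝ E]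
    {M : Type*} [TopologicalSpace M] [ChartedSpace E M] (x y : M) :=
  {γ : Path x y // IsPiecewiseSmooth E γ}

namespace PSPath

variable {E : Type*} [NormedAddCommGroup E] [NormedSpace ℝ E]
  {M : Type*} [TopologicalSpace M] [ChartedSpace E M]

/-- The constant path. -/
def refl (x : M) : PSPath E x x := ⟨Path.refl x, IsPiecewiseSmooth.refl x⟩

/-- The reversed path. -/
def symm {x y : M} (γ : PSPath E x y) : PSPath E y x := ⟨γ.1.symm, γ.2.symm⟩

/-- The standard concatenation: first `γ`, then `γ'`. -/
def trans {x y z : M} (γ : PSPath E x y) (γ' : PSPath E y z) : PSPath E x z :=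
  ⟨γ.1.trans γ'.1, γ.2.trans γ'.2⟩

end PSPath

namespace LieGroupoid

variable {EM EG M G : Type*}
  [NormedAddCommGroup EM] [NormedSpace ℝ EM] [NormedAddCommGroup EG] [NormedSpace ℝ EG]
  [TopologicalSpace M] [ChartedSpace EM M] [TopologicalSpace G] [ChartedSpace EG G]
  (𝒢 : LieGroupoid EM EG M G)

theorem continuous_s : Continuous 𝒢.s := 𝒢.s_submersion.contMDiff.continuous

theorem continuous_t : Continuous 𝒢.t := 𝒢.t_submersion.contMDiff.continuous

/-- Arrows from `x` to `y`. -/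
def Arrow (x y : M) := {g : G // 𝒢.s g = x ∧ 𝒢.t g = y}

variable {𝒢}

/-- The unit arrow `1_x`. -/
def Arrow.id (x : M) : 𝒢.Arrow x x := ⟨𝒢.unit x, 𝒢.s_unit x, 𝒢.t_unit x⟩

/-- The product `h g` of an arrow `g : x → y` and an arrow `h : y → z`. -/
def Arrow.trans {x y z : M} (g : 𝒢.Arrow x y) (h : 𝒢.Arrow y z) : 𝒢.Arrow x z :=
  ⟨𝒢.comp h.1 g.1, (𝒢.s_comp _ _ (h.2.1.trans g.2.2.symm)).trans g.2.1,
    (𝒢.t_comp _ _ (h.2.1.trans g.2.2.symm)).trans h.2.2⟩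

/-- The inverse arrow. -/
def Arrow.symm {x y : M} (g : 𝒢.Arrow x y) : 𝒢.Arrow y x :=
  ⟨𝒢.inv g.1, (𝒢.s_inv _).trans g.2.2, (𝒢.t_inv _).trans g.2.1⟩

variable (𝒢)

/-! ### `G`-paths and `G`-homotopy -/

/-- A `G`-path `σₙ gₙ σₙ₋₁ ⋯ σ₁ g₁ σ₀` from `x = σ₀(0)` to `y = σₙ(1)`: piecewise smooth paths
`σⱼ` in `M` and arrows `gⱼ` from `σⱼ₋₁(1)` to `σⱼ(0)`.
`single σ₀` is a `G`-path of order `0`; `cons σ₀ g₁ ρ` is `ρ g₁ σ₀`. -/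
inductive GPath : M → M → Type _
  | single {x y : M} (γ : PSPath EM x y) : GPath x y
  | cons {x a b y : M} (γ : PSPath EM x a) (g : 𝒢.Arrow a b) (ρ : GPath b y) : GPath x y

/-- `G` is `G`-connected if any two points of `M` are joined by a `G`-path. -/
def IsGConnected : Prop := ∀ x y : M, Nonempty (𝒢.GPath x y)

variable {𝒢}

namespace GPath

/-- `glue σ g σ'` is the `G`-path `σ' g σ`. -/
def glue {x a b y : M} : 𝒢.GPath x a → 𝒢.Arrow a b → 𝒢.GPath b y → 𝒢.GPath x y
  | single γ, g, τ => cons γ g τ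
  | cons γ h ρ, g, τ => cons γ h (glue ρ g τ)

/-- The concatenation `σ ∗ σ' = σ' 1 σ` (first `σ`, then `σ'`). -/
def concat {x y z : M} (σ : 𝒢.GPath x y) (σ' : 𝒢.GPath y z) : 𝒢.GPath x z :=
  glue σ (Arrow.id y) σ'

/-- The inverse `G`-path `σ₀⁻¹ g₁⁻¹ σ₁⁻¹ ⋯ gₙ⁻¹ σₙ⁻¹`. -/
def reverse {x y : M} : 𝒢.GPath x y → 𝒢.GPath y x
  | single γ => single γ.symm
  | cons γ g ρ => glue (reverse ρ) g.symm (single γ.symm)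

/-- The elementary multiplication and concatenation equivalences: `Step σ σ'` if `σ'` arises from
`σ` by replacing some `h c g` by the product `hg`, where `c` is a constant path, or by replacing
some `γ' 1 γ` by the concatenated path `γ' · γ` (first `γ`). -/
inductive Step : {x y : M} → 𝒢.GPath x y → 𝒢.GPath x y → Prop
  | mul {x a b c y : M} (γ : PSPath EM x a) (g : 𝒢.Arrow a b) (h : 𝒢.Arrow b c)
      (ρ : 𝒢.GPath c y) :
      Step (cons γ g (cons (PSPath.refl b) h ρ)) (cons γ (g.trans h) ρ)
  | concat_single {x a y : M} (γ : PSPath EM x a) (γ' : PSPath EM a y) :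
      Step (cons γ (Arrow.id a) (single γ')) (single (γ.trans γ'))
  | concat_cons {x a b c y : M} (γ : PSPath EM x a) (γ' : PSPath EM a b) (g : 𝒢.Arrow b c)
      (ρ : 𝒢.GPath c y) :
      Step (cons γ (Arrow.id a) (cons γ' g ρ)) (cons (γ.trans γ') g ρ)
  | cons {x a b y : M} (γ : PSPath EM x a) (g : 𝒢.Arrow a b) {ρ ρ' : 𝒢.GPath b y} :
      Step ρ ρ' → Step (cons γ g ρ) (cons γ g ρ')

/-- `Deform p σ σ'`: a continuous family of `G`-paths of fixed order between `σ` and `σ'`, whose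
starting point moves along `p` and whose end point `y` is fixed. It consists of homotopies
`Dⱼ : [0,1] × [0,1] → M` from `σⱼ` to `σⱼ'` and paths `dⱼ : [0,1] → G` from `gⱼ` to `gⱼ'` with
`s (dⱼ τ) = Dⱼ₋₁ (τ, 1)` and `t (dⱼ τ) = Dⱼ (τ, 0)`. -/
inductive Deform : {x x' y : M} → (unitInterval → M) → 𝒢.GPath x y → 𝒢.GPath x' y → Prop
  | single {x x' y : M} {γ : PSPath EM x y} {γ' : PSPath EM x' y} (D : C(unitInterval × unitInterval, M))
      (D_zero : ∀ r, D (0, r) = γ.1 r) (D_one : ∀ r, D (1, r) = γ'.1 r)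
      (D_end : ∀ τ, D (τ, 1) = y) :
      Deform (fun τ => D (τ, 0)) (single γ) (single γ')
  | cons {x a b x' a' b' y : M} {γ : PSPath EM x a} {γ' : PSPath EM x' a'}
      {g : 𝒢.Arrow a b} {g' : 𝒢.Arrow a' b'} {ρ : 𝒢.GPath b y} {ρ' : 𝒢.GPath b' y}
      (D : C(unitInterval × unitInterval, M)) (d : C(unitInterval, G))
      (D_zero : ∀ r, D (0, r) = γ.1 r) (D_one : ∀ r, D (1, r) = γ'.1 r)
      (d_zero : d 0 = g.1) (d_one : d 1 = g'.1)
      (s_d : ∀ τ, 𝒢.s (d τ) = D (τ, 1))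
      (h : Deform (fun τ => 𝒢.t (d τ)) ρ ρ') :
      Deform (fun τ => D (τ, 0)) (cons γ g ρ) (cons γ' g' ρ')

/-- A deformation between `G`-paths of the same order, with fixed end points `x` and `y`. -/
def Deformation {x y : M} (σ σ' : 𝒢.GPath x y) : Prop := Deform (fun _ => x) σ σ'

/-- `σ` and `σ'` are `G`-homotopic if one can pass from one to the other by a finite sequence of
elementary equivalences and deformations. -/
def GHomotopic {x y : M} : 𝒢.GPath x y → 𝒢.GPath x y → Prop :=
  Relation.EqvGen fun σ σ' => Step σ σ' ∨ Deformation σ σ'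

/-! The groupoid laws up to `G`-homotopy. -/

theorem GHomotopic.refl {x y : M} (σ : 𝒢.GPath x y) : GHomotopic σ σ :=
  Relation.EqvGen.refl _

theorem GHomotopic.symm {x y : M} {σ σ' : 𝒢.GPath x y} (h : GHomotopic σ σ') :
    GHomotopic σ' σ := Relation.EqvGen.symm _ _ h

theorem GHomotopic.trans {x y : M} {σ σ' σ'' : 𝒢.GPath x y} (h : GHomotopic σ σ')
    (h' : GHomotopic σ' σ'') : GHomotopic σ σ'' := Relation.EqvGen.trans _ _ _ h h'

theorem Step.gHomotopic {x y : M} {σ σ' : 𝒢.GPath x y} (h : Step σ σ') : GHomotopic σ σ' :=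
  .rel _ _ (.inl h)

theorem Deformation.gHomotopic {x y : M} {σ σ' : 𝒢.GPath x y} (h : Deformation σ σ') :
    GHomotopic σ σ' := .rel _ _ (.inr h)

/-- A map respecting the generators respects `G`-homotopy. -/
theorem GHomotopic.map {x y x' y' : M} (f : 𝒢.GPath x y → 𝒢.GPath x' y')
    (h₁ : ∀ σ σ', Step σ σ' → GHomotopic (f σ) (f σ'))
    (h₂ : ∀ σ σ', Deformation σ σ' → GHomotopic (f σ) (f σ'))
    {σ σ' : 𝒢.GPath x y} (h : GHomotopic σ σ') : GHomotopic (f σ) (f σ') := by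
  induction h with
  | rel _ _ h => exact h.elim (h₁ _ _) (h₂ _ _)
  | refl _ => exact .refl _
  | symm _ _ _ ih => exact ih.symm
  | trans _ _ _ _ _ ih ih' => exact ih.trans ih'

theorem Deform.single' {x x' y : M} {γ : PSPath EM x y} {γ' : PSPath EM x' y} (p : unitInterval → M)
    (D : C(unitInterval × unitInterval, M)) (hp : ∀ τ, D (τ, 0) = p τ)
    (D_zero : ∀ r, D (0, r) = γ.1 r) (D_one : ∀ r, D (1, r) = γ'.1 r)
    (D_end : ∀ τ, D (τ, 1) = y) :
    Deform (𝒢 := 𝒢) p (.single γ) (.single γ') := by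
  obtain rfl : (fun τ => D (τ, 0)) = p := funext hp
  exact .single D D_zero D_one D_end

theorem Deform.cons' {x a b x' a' b' y : M} {γ : PSPath EM x a} {γ' : PSPath EM x' a'}
    {g : 𝒢.Arrow a b} {g' : 𝒢.Arrow a' b'} {ρ : 𝒢.GPath b y} {ρ' : 𝒢.GPath b' y}
    (p q : unitInterval → M) (D : C(unitInterval × unitInterval, M)) (d : C(unitInterval, G)) (hp : ∀ τ, D (τ, 0) = p τ)
    (hq : ∀ τ, 𝒢.t (d τ) = q τ)
    (D_zero : ∀ r, D (0, r) = γ.1 r) (D_one : ∀ r, D (1, r) = γ'.1 r)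
    (d_zero : d 0 = g.1) (d_one : d 1 = g'.1)
    (s_d : ∀ τ, 𝒢.s (d τ) = D (τ, 1))
    (h : Deform q ρ ρ') :
    Deform p (GPath.cons γ g ρ) (GPath.cons γ' g' ρ') := by
  obtain rfl : (fun τ => D (τ, 0)) = p := funext hp
  obtain rfl : (fun τ => 𝒢.t (d τ)) = q := funext hq
  exact .cons D d D_zero D_one d_zero d_one s_d h

theorem Deform.cons_const {x a b y : M} (γ : PSPath EM x a) (g : 𝒢.Arrow a b)
    {ρ ρ' : 𝒢.GPath b y} (h : Deform (fun _ => b) ρ ρ') :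
    Deform (fun _ => x) (GPath.cons γ g ρ) (GPath.cons γ g ρ') :=
  .cons' _ _ ⟨fun p => γ.1 p.2, by fun_prop⟩ (.const _ g.1) (fun _ => γ.1.source)
    (fun _ => g.2.2) (fun _ => rfl) (fun _ => rfl) rfl rfl
    (fun _ => g.2.1.trans γ.1.target.symm) h

theorem Deform.rfl {x y : M} (σ : 𝒢.GPath x y) : Deform (fun _ => x) σ σ := by
  induction σ with
  | single γ =>
    exact .single' _ ⟨fun p => γ.1 p.2, by fun_prop⟩ (fun _ => γ.1.source)
      (fun _ => by rfl) (fun _ => by rfl) (fun _ => γ.1.target)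
  | cons γ g ρ ih => exact .cons_const γ g ih

theorem GHomotopic.cons {x a b y : M} (γ : PSPath EM x a) (g : 𝒢.Arrow a b)
    {ρ ρ' : 𝒢.GPath b y} (h : GHomotopic ρ ρ') :
    GHomotopic (GPath.cons γ g ρ) (GPath.cons γ g ρ') :=
  h.map _ (fun _ _ h => (h.cons γ g).gHomotopic)
    (fun _ _ h => Deformation.gHomotopic (Deform.cons_const γ g h))

theorem GHomotopic.glue_right {x a b y : M} (α : 𝒢.GPath x a) (g : 𝒢.Arrow a b)
    {ρ ρ' : 𝒢.GPath b y} (h : GHomotopic ρ ρ') : GHomotopic (glue α g ρ) (glue α g ρ') := by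
  induction α with
  | single γ => exact h.cons γ g
  | cons γ k β ih => exact (ih g).cons γ k

theorem Step.glue_left {x a b y : M} {σ σ' : 𝒢.GPath x a} (h : Step σ σ') (g : 𝒢.Arrow a b)
    (τ : 𝒢.GPath b y) : Step (glue σ g τ) (glue σ' g τ) := by
  induction h with
  | mul γ k l ρ => exact .mul γ k l _
  | concat_single γ γ' => exact .concat_cons γ γ' g τ
  | concat_cons γ γ' k ρ => exact .concat_cons γ γ' k _
  | cons γ k _ ih => exact .cons γ k (ih g)

theorem Deform.glue_left {x x' a b y : M} {p : unitInterval → M} {σ : 𝒢.GPath x a} {σ' : 𝒢.GPath x' a}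
    (h : Deform p σ σ') (g : 𝒢.Arrow a b) (τ : 𝒢.GPath b y) :
    Deform p (glue σ g τ) (glue σ' g τ) := by
  induction h with
  | single D h₀ h₁ h₂ =>
    exact .cons' _ _ D (.const _ g.1) (fun _ => by rfl) (fun _ => g.2.2) h₀ h₁ (by rfl) (by rfl)
      (fun r => g.2.1.trans (h₂ r).symm) (Deform.rfl τ)
  | cons D d h₀ h₁ h₂ h₃ h₄ _ ih => exact .cons D d h₀ h₁ h₂ h₃ h₄ (ih g)

theorem GHomotopic.glue_left {x a b y : M} {σ σ' : 𝒢.GPath x a} (h : GHomotopic σ σ')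
    (g : 𝒢.Arrow a b) (τ : 𝒢.GPath b y) : GHomotopic (glue σ g τ) (glue σ' g τ) :=
  h.map (fun σ => glue σ g τ) (fun _ _ h => (h.glue_left g τ).gHomotopic)
    (fun _ _ h => Deformation.gHomotopic (Deform.glue_left h g τ))

theorem GHomotopic.single_of_homotopy {x y : M} {γ γ' : PSPath EM x y}
    (F : γ.1.Homotopy γ'.1) : GHomotopic (𝒢 := 𝒢) (.single γ) (.single γ') :=
  Deformation.gHomotopic (Deform.single' _ F.toContinuousMap F.source
    (fun r => F.apply_zero r) (fun r => F.apply_one r) F.target)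

theorem GHomotopic.cons_of_homotopy {x a b y : M} {γ γ' : PSPath EM x a}
    (F : γ.1.Homotopy γ'.1) (g : 𝒢.Arrow a b) (ρ : 𝒢.GPath b y) :
    GHomotopic (.cons γ g ρ) (.cons γ' g ρ) :=
  Deformation.gHomotopic (Deform.cons' _ _ F.toContinuousMap (.const _ g.1) F.source
    (fun _ => g.2.2) (fun r => F.apply_zero r) (fun r => F.apply_one r) rfl rfl
    (fun r => g.2.1.trans (F.target r).symm) (Deform.rfl ρ))

theorem glue_assoc {x a b c d y : M} (α : 𝒢.GPath x a) (g : 𝒢.Arrow a b) (β : 𝒢.GPath b c)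
    (h : 𝒢.Arrow c d) (τ : 𝒢.GPath d y) :
    glue (glue α g β) h τ = glue α g (glue β h τ) := by
  induction α with
  | single γ => rfl
  | cons γ k ρ ih => exact congrArg (GPath.cons γ k) (ih g)

theorem glue_mul {x a b c y : M} (α : 𝒢.GPath x a) (g : 𝒢.Arrow a b) (h : 𝒢.Arrow b c)
    (τ : 𝒢.GPath c y) :
    GHomotopic (glue α g (.cons (PSPath.refl b) h τ)) (glue α (g.trans h) τ) := by
  induction α with
  | single γ => exact (Step.mul γ g h τ).gHomotopic
  | cons γ k ρ ih => exact (ih g).cons γ k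

theorem refl_concat {x y : M} (σ : 𝒢.GPath x y) :
    GHomotopic (concat (.single (PSPath.refl x)) σ) σ := by
  cases σ with
  | single γ =>
    exact (Step.concat_single _ γ).gHomotopic.trans
      (.single_of_homotopy (Path.Homotopy.reflTrans γ.1))
  | cons γ g ρ =>
    exact (Step.concat_cons _ γ g ρ).gHomotopic.trans
      (.cons_of_homotopy (Path.Homotopy.reflTrans γ.1) g ρ)

theorem concat_refl {x y : M} (σ : 𝒢.GPath x y) :
    GHomotopic (concat σ (.single (PSPath.refl y))) σ := by
  induction σ with
  | single γ =>
    exact (Step.concat_single γ _).gHomotopic.trans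
      (.single_of_homotopy (Path.Homotopy.transRefl γ.1))
  | cons γ g ρ ih => exact ih.cons γ g

theorem Arrow.symm_trans {x y : M} (g : 𝒢.Arrow x y) : g.symm.trans g = Arrow.id y := by
  obtain ⟨g, rfl, rfl⟩ := g
  exact Subtype.ext (𝒢.comp_inv g)

theorem Arrow.trans_symm {x y : M} (g : 𝒢.Arrow x y) : g.trans g.symm = Arrow.id x := by
  obtain ⟨g, rfl, rfl⟩ := g
  exact Subtype.ext (𝒢.inv_comp g)

theorem reverse_concat {x y : M} (σ : 𝒢.GPath x y) :
    GHomotopic (concat (reverse σ) σ) (.single (PSPath.refl y)) := by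
  induction σ with
  | single γ =>
    exact (Step.concat_single γ.symm γ).gHomotopic.trans
      (.single_of_homotopy (Path.Homotopy.reflSymmTrans γ.1).symm)
  | cons γ g ρ ih =>
    have h : concat (reverse (.cons γ g ρ)) (.cons γ g ρ) =
        glue (reverse ρ) g.symm (.cons γ.symm (Arrow.id _) (.cons γ g ρ)) := glue_assoc ..
    rw [h]
    refine (GHomotopic.glue_right _ _ ((Step.concat_cons _ _ _ _).gHomotopic.trans
      (.cons_of_homotopy (γ' := PSPath.refl _) (Path.Homotopy.reflSymmTrans γ.1).symm g ρ))).trans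
      ((glue_mul _ _ _ _).trans ?_)
    rw [Arrow.symm_trans]
    exact ih

theorem concat_reverse {x y : M} (σ : 𝒢.GPath x y) :
    GHomotopic (concat σ (reverse σ)) (.single (PSPath.refl x)) := by
  induction σ with
  | single γ =>
    exact (Step.concat_single γ γ.symm).gHomotopic.trans
      (.single_of_homotopy (Path.Homotopy.reflTransSymm γ.1).symm)
  | cons γ g ρ ih =>
    have h : concat (.cons γ g ρ) (reverse (.cons γ g ρ)) =
        .cons γ g (glue (concat ρ (reverse ρ)) g.symm (.single γ.symm)) :=
      congrArg (GPath.cons γ g) (glue_assoc ρ _ (reverse ρ) g.symm (.single γ.symm)).symm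
    rw [h]
    refine ((ih.glue_left g.symm (.single γ.symm)).cons γ g).trans
      ((Step.mul _ _ _ _).gHomotopic.trans ?_)
    rw [Arrow.trans_symm]
    exact (Step.concat_single γ γ.symm).gHomotopic.trans
      (.single_of_homotopy (Path.Homotopy.reflTransSymm γ.1).symm)

theorem GHomotopic.concat {x y z : M} {σ σ' : 𝒢.GPath x y} {τ τ' : 𝒢.GPath y z}
    (h : GHomotopic σ σ') (h' : GHomotopic τ τ') :
    GHomotopic (σ.concat τ) (σ'.concat τ') :=
  (h.glue_left _ τ).trans (h'.glue_right σ' _)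

theorem GHomotopic.reverse {x y : M} {σ σ' : 𝒢.GPath x y} (h : GHomotopic σ σ') :
    GHomotopic σ.reverse σ'.reverse := by
  have h1 : GHomotopic σ.reverse (σ.reverse.concat (σ'.concat σ'.reverse)) :=
    (concat_refl _).symm.trans ((concat_reverse σ').symm.glue_right _ _)
  have h2 : σ.reverse.concat (σ'.concat σ'.reverse) = (σ.reverse.concat σ').concat σ'.reverse :=
    (glue_assoc ..).symm
  rw [h2] at h1
  exact h1.trans (((((h.symm.glue_right _ _).trans (reverse_concat σ))).glue_left _ _).trans
    (refl_concat _))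

end GPath

/-! ### The fundamental group -/

/-- `G`-homotopy as an equivalence relation on the `G`-paths from `x` to `y`. -/
def gHomotopySetoid (𝒢 : LieGroupoid EM EG M G) (x y : M) : Setoid (𝒢.GPath x y) where
  r := GPath.GHomotopic
  iseqv := ⟨GPath.GHomotopic.refl, GPath.GHomotopic.symm, GPath.GHomotopic.trans⟩

/-- The arrows from `x` to `y` of the fundamental groupoid `Π₁(G)`. -/
def FundamentalHom (𝒢 : LieGroupoid EM EG M G) (x y : M) := Quotient (𝒢.gHomotopySetoid x y)

/-- The fundamental group `Π₁(G, x₀)`: the isotropy group at `x₀` of the fundamental groupoid. -/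
def FundamentalGroup (𝒢 : LieGroupoid EM EG M G) (x₀ : M) := 𝒢.FundamentalHom x₀ x₀

/-- The `G`-homotopy class of a `G`-loop. -/
def homotopyClass {x₀ : M} (σ : 𝒢.GPath x₀ x₀) : 𝒢.FundamentalGroup x₀ :=
  Quotient.mk (𝒢.gHomotopySetoid x₀ x₀) σ

/-- The group structure is `[σ] * [σ'] = [σ ∗ σ']`. -/
instance (x₀ : M) : Group (𝒢.FundamentalGroup x₀) where
  mul a b := Quotient.liftOn₂ a b (fun σ τ => homotopyClass (σ.concat τ))
    (fun _ _ _ _ h h' => Quotient.sound (GPath.GHomotopic.concat h h'))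
  one := homotopyClass (.single (PSPath.refl x₀))
  inv a := Quotient.liftOn a (fun σ => homotopyClass σ.reverse)
    (fun _ _ h => Quotient.sound (GPath.GHomotopic.reverse h))
  mul_assoc := by
    rintro ⟨a⟩ ⟨b⟩ ⟨c⟩
    exact congrArg homotopyClass (GPath.glue_assoc ..)
  one_mul := by
    rintro ⟨a⟩
    exact Quotient.sound (GPath.refl_concat a)
  mul_one := by
    rintro ⟨a⟩
    exact Quotient.sound (GPath.concat_refl a)
  inv_mul_cancel := by
    rintro ⟨a⟩
    exact Quotient.sound (GPath.reverse_concat a)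

end LieGroupoid

/-! ### Total singular homology -/

namespace LieGroupoid

variable {EM EG : Type*} {M G : Type u}
  [NormedAddCommGroup EM] [NormedSpace ℝ EM] [NormedAddCommGroup EG] [NormedSpace ℝ EG]
  [TopologicalSpace M] [ChartedSpace EM M] [TopologicalSpace G] [ChartedSpace EG G]
  (𝒢 : LieGroupoid EM EG M G)

/-- The nerve: `G⁽⁰⁾ = M`, and `G⁽ⁿ⁾` is the space of `(g₁, …, gₙ)` with `s gⱼ = t gⱼ₊₁`. -/
def Nerve (𝒢 : LieGroupoid EM EG M G) : ℕ → Type u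
  | 0 => M
  | n + 1 => {g : Fin (n + 1) → G // ∀ j : Fin n, 𝒢.s (g j.castSucc) = 𝒢.t (g j.succ)}

instance : ∀ n, TopologicalSpace (𝒢.Nerve n)
  | 0 => inferInstanceAs (TopologicalSpace M)
  | n + 1 => inferInstanceAs (TopologicalSpace
      {g : Fin (n + 1) → G // ∀ j : Fin n, 𝒢.s (g j.castSucc) = 𝒢.t (g j.succ)})

/-- The `k`-th face of a string of `n + 2` composable arrows: the first arrow is dropped if
`k = 0`, the last one if `k = n + 2`, and `gₖ`, `gₖ₊₁` are replaced by their product otherwise. -/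
def faceArrow {n : ℕ} (k : Fin (n + 3)) (g : Fin (n + 2) → G) (j : Fin (n + 1)) : G :=
  if (j : ℕ) + 1 < k then g j.castSucc
  else if (j : ℕ) + 1 = k then 𝒢.comp (g j.castSucc) (g j.succ)
  else g j.succ

theorem faceArrow_composable {n : ℕ} (k : Fin (n + 3)) (g : 𝒢.Nerve (n + 2)) (j : Fin n) :
    𝒢.s (𝒢.faceArrow k g.1 j.castSucc) = 𝒢.t (𝒢.faceArrow k g.1 j.succ) := by
  have h0 := g.2 j.castSucc
  have h1 := g.2 j.succ
  have e : (j.castSucc.succ : Fin (n + 2)) = j.succ.castSucc := rfl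
  simp only [faceArrow, Fin.val_castSucc, Fin.val_succ]
  rw [e] at h0 ⊢
  split_ifs <;> first
    | omega
    | simp only [𝒢.s_comp _ _ h0, 𝒢.t_comp _ _ h1, h0, h1]

theorem continuous_faceArrow {n : ℕ} (k : Fin (n + 3)) (j : Fin (n + 1)) :
    Continuous fun g : 𝒢.Nerve (n + 2) => 𝒢.faceArrow k g.1 j := by
  have hc : ∀ i : Fin (n + 2), Continuous fun g : 𝒢.Nerve (n + 2) => g.1 i := fun i =>
    (continuous_apply i).comp continuous_subtype_val
  unfold faceArrow
  split_ifs
  · exact hc _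
  · exact 𝒢.smooth_comp.continuousOn.comp_continuous ((hc j.castSucc).prodMk (hc j.succ))
      (fun g => g.2 j)
  · exact hc _

/-- The face maps `dₖ : G⁽ⁿ⁺¹⁾ → G⁽ⁿ⁾` of the nerve, with `d₀ = t` and `d₁ = s` on `G⁽¹⁾ = G`. -/
def nerveFace : ∀ n : ℕ, Fin (n + 2) → C(𝒢.Nerve (n + 1), 𝒢.Nerve n)
  | 0, k =>
    have hc : Continuous fun g : 𝒢.Nerve 1 => g.1 0 :=
      (continuous_apply 0).comp continuous_subtype_val
    if k = 0 then ⟨fun g => 𝒢.t (g.1 0), 𝒢.continuous_t.comp hc⟩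
    else ⟨fun g => 𝒢.s (g.1 0), 𝒢.continuous_s.comp hc⟩
  | _ + 1, k =>
    { toFun := fun g => ⟨𝒢.faceArrow k g.1, 𝒢.faceArrow_composable k g⟩
      continuous_toFun :=
        Continuous.subtype_mk (continuous_pi fun j => 𝒢.continuous_faceArrow k j) _ }

/-- The inclusion of the `j`-th face of the standard `(q + 1)`-simplex. -/
def simplexFace (q : ℕ) (j : Fin (q + 2)) :
    C(stdSimplex ℝ (Fin (q + 1)), stdSimplex ℝ (Fin (q + 2))) :=
  ⟨stdSimplex.map j.succAbove, stdSimplex.continuous_map _⟩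

/-- Singular `q`-simplices of `G⁽ⁿ⁾`. -/
abbrev Simplex (𝒢 : LieGroupoid EM EG M G) (q n : ℕ) := C(stdSimplex ℝ (Fin (q + 1)), 𝒢.Nerve n)

/-- All singular `q`-simplices of all `G⁽ⁿ⁾`, as triples `⟨q, n, σ⟩`. -/
abbrev BiSimplex (𝒢 : LieGroupoid EM EG M G) := Σ q n : ℕ, 𝒢.Simplex q n

/-- The direct sum of all groups of singular chains `C_q(G⁽ⁿ⁾)`: the free abelian group on the
singular simplices of all `G⁽ⁿ⁾`. -/
abbrev Chains (𝒢 : LieGroupoid EM EG M G) := 𝒢.BiSimplex →₀ ℤ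

/-- The singular boundary `d = ∑ (-1)ʲ dⱼ : C_q(G⁽ⁿ⁾) → C_{q-1}(G⁽ⁿ⁾)` on a simplex. -/
def singularBoundary : ∀ q n : ℕ, 𝒢.Simplex q n → 𝒢.Chains
  | 0, _, _ => 0
  | q + 1, n, σ => ∑ j : Fin (q + 2),
      Finsupp.single ⟨q, n, σ.comp (simplexFace q j)⟩ ((-1) ^ (j : ℕ))

/-- The simplicial boundary `∂ = ∑ (-1)ᵏ dₖ : C_q(G⁽ⁿ⁾) → C_q(G⁽ⁿ⁻¹⁾)` on a simplex. -/
def nerveBoundary : ∀ q n : ℕ, 𝒢.Simplex q n → 𝒢.Chains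
  | _, 0, _ => 0
  | q, n + 1, σ => ∑ k : Fin (n + 2),
      Finsupp.single ⟨q, n, (𝒢.nerveFace n k).comp σ⟩ ((-1) ^ (k : ℕ))

/-- The total differential `δ γ = (-1)^{q+n} ∂γ + (-1)^q dγ` for `γ ∈ C_q(G⁽ⁿ⁾)`. -/
def totalDifferential : 𝒢.Chains →ₗ[ℤ] 𝒢.Chains :=
  Finsupp.linearCombination ℤ fun b : 𝒢.BiSimplex =>
    (-1 : ℤ) ^ (b.1 + b.2.1) • 𝒢.nerveBoundary b.1 b.2.1 b.2.2 +
      (-1 : ℤ) ^ b.1 • 𝒢.singularBoundary b.1 b.2.1 b.2.2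

/-- Total chains of degree `v`: the direct sum of the `C_q(G⁽ⁿ⁾)` with `q + n = v`. -/
def totalChains (v : ℕ) : Submodule ℤ 𝒢.Chains :=
  Finsupp.supported ℤ ℤ {b : 𝒢.BiSimplex | b.1 + b.2.1 = v}

/-- Total cycles of degree `v`. -/
def totalCycles (v : ℕ) : Submodule ℤ 𝒢.Chains :=
  𝒢.totalChains v ⊓ LinearMap.ker 𝒢.totalDifferential

/-- Total boundaries of degree `v`. -/
def totalBoundaries (v : ℕ) : Submodule ℤ 𝒢.Chains :=
  (𝒢.totalChains (v + 1)).map 𝒢.totalDifferential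

/-- The total singular homology `H_v(G, ℤ)`: cycles modulo boundaries. -/
abbrev TotalHomology (v : ℕ) :=
  ↥(𝒢.totalCycles v) ⧸ (𝒢.totalBoundaries v).comap (𝒢.totalCycles v).subtype

variable {𝒢}

/-- A point of `M` as a `0`-simplex of `G⁽⁰⁾`. -/
def pointSimplex (x : M) : 𝒢.Simplex 0 0 := ContinuousMap.const _ (show 𝒢.Nerve 0 from x)

/-- An arrow as a `0`-simplex of `G⁽¹⁾`. -/
def arrowSimplex (g : G) : 𝒢.Simplex 0 1 :=
  ContinuousMap.const _ (show 𝒢.Nerve 1 from ⟨fun _ => g, fun j => j.elim0⟩)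

/-- A path as a `1`-simplex of `G⁽⁰⁾`; the vertices `0`, `1` go to the source and the target. -/
def pathSimplex {x y : M} (γ : Path x y) : 𝒢.Simplex 1 0 :=
  (γ.toContinuousMap.comp ⟨stdSimplexHomeomorphUnitInterval,
    stdSimplexHomeomorphUnitInterval.continuous⟩ : C(stdSimplex ℝ (Fin 2), M))

/-- The total `1`-chain `∑ σⱼ + ∑ gⱼ` of a `G`-path `σₙ gₙ ⋯ σ₁ g₁ σ₀`. -/
def GPath.chain {x y : M} : 𝒢.GPath x y → 𝒢.Chains
  | .single γ => Finsupp.single ⟨1, 0, pathSimplex γ.1⟩ 1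
  | .cons γ g ρ =>
      Finsupp.single ⟨1, 0, pathSimplex γ.1⟩ 1 + Finsupp.single ⟨0, 1, arrowSimplex g.1⟩ 1 + ρ.chain

theorem totalDifferential_path {x y : M} (γ : Path x y) :
    𝒢.totalDifferential (Finsupp.single ⟨1, 0, pathSimplex γ⟩ 1) =
      Finsupp.single ⟨0, 0, pointSimplex x⟩ 1 - Finsupp.single ⟨0, 0, pointSimplex y⟩ 1 := by
  have key : ∀ j : Fin 2, ∀ p : stdSimplex ℝ (Fin 1),
      stdSimplexHomeomorphUnitInterval (simplexFace 0 j p) = if j = 0 then 1 else 0 := by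
    intro j p
    have hp : p = ⟨_, single_mem_stdSimplex ℝ 0⟩ := Subsingleton.elim _ _
    rw [hp]
    fin_cases j
    · exact congrArg stdSimplexHomeomorphUnitInterval
        (stdSimplex.map_vertex (S := ℝ) (Fin.succAbove (0 : Fin 2)) 0)
    · exact congrArg stdSimplexHomeomorphUnitInterval
        (stdSimplex.map_vertex (S := ℝ) (Fin.succAbove (1 : Fin 2)) 0)
  have h0 : (pathSimplex (𝒢 := 𝒢) γ).comp (simplexFace 0 0) = pointSimplex y :=
    ContinuousMap.ext fun p => (congrArg γ (key 0 p)).trans γ.target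
  have h1 : (pathSimplex (𝒢 := 𝒢) γ).comp (simplexFace 0 1) = pointSimplex x :=
    ContinuousMap.ext fun p => (congrArg γ (key 1 p)).trans γ.source
  have hs : 𝒢.singularBoundary 1 0 (pathSimplex γ) =
      Finsupp.single ⟨0, 0, pointSimplex y⟩ 1 - Finsupp.single ⟨0, 0, pointSimplex x⟩ 1 := by
    refine (Fin.sum_univ_two _).trans ?_
    rw [h0, h1, sub_eq_add_neg, ← Finsupp.single_neg]
    rfl
  rw [totalDifferential, Finsupp.linearCombination_single]
  change (1 : ℤ) • ((-1 : ℤ) ^ (1 + 0) • (0 : 𝒢.Chains) +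
    (-1 : ℤ) ^ 1 • 𝒢.singularBoundary 1 0 (pathSimplex γ)) = _
  rw [hs]
  simp

theorem totalDifferential_arrow {x y : M} (g : 𝒢.Arrow x y) :
    𝒢.totalDifferential (Finsupp.single ⟨0, 1, arrowSimplex g.1⟩ 1) =
      Finsupp.single ⟨0, 0, pointSimplex x⟩ 1 - Finsupp.single ⟨0, 0, pointSimplex y⟩ 1 := by
  obtain ⟨g, rfl, rfl⟩ := g
  have hs : 𝒢.nerveBoundary 0 1 (arrowSimplex g) =
      Finsupp.single ⟨0, 0, pointSimplex (𝒢.t g)⟩ 1 - Finsupp.single ⟨0, 0, pointSimplex (𝒢.s g)⟩ 1 := by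
    refine (Fin.sum_univ_two _).trans ?_
    rw [sub_eq_add_neg, ← Finsupp.single_neg]
    rfl
  rw [totalDifferential, Finsupp.linearCombination_single]
  change (1 : ℤ) • ((-1 : ℤ) ^ (0 + 1) • 𝒢.nerveBoundary 0 1 (arrowSimplex g) +
    (-1 : ℤ) ^ 0 • (0 : 𝒢.Chains)) = _
  rw [hs]
  simp

theorem GPath.totalDifferential_chain {x y : M} (σ : 𝒢.GPath x y) :
    𝒢.totalDifferential σ.chain =
      Finsupp.single ⟨0, 0, pointSimplex x⟩ 1 - Finsupp.single ⟨0, 0, pointSimplex y⟩ 1 := by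
  induction σ with
  | single γ => exact totalDifferential_path γ.1
  | cons γ g ρ ih =>
    rw [GPath.chain, map_add, map_add, totalDifferential_path, totalDifferential_arrow, ih]
    abel

theorem GPath.chain_mem {x y : M} (σ : 𝒢.GPath x y) : σ.chain ∈ 𝒢.totalChains 1 := by
  induction σ with
  | single γ => exact Finsupp.single_mem_supported ℤ _ rfl
  | cons γ g ρ ih =>
    exact add_mem (add_mem (Finsupp.single_mem_supported ℤ _ rfl)
      (Finsupp.single_mem_supported ℤ _ rfl)) ih

/-- The class `|σ| ∈ H₁(G, ℤ)` of a `G`-loop `σ`. -/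
def loopClass {x₀ : M} (σ : 𝒢.GPath x₀ x₀) : 𝒢.TotalHomology 1 :=
  Submodule.Quotient.mk ⟨σ.chain, σ.chain_mem, LinearMap.mem_ker.2
    (σ.totalDifferential_chain.trans (sub_self _))⟩

end LieGroupoid

end

/-! Generators of total degree 2 supply the relations that `GHomotopic` imposes. A composable pair
makes a product of arrows homologous to their sum, so units are null. A triangle in `M` does the
same for concatenated paths, and two triangles form a square, which handles homotopies. A path of
arrows compares its two end arrows along its source and target paths. Hence
`GHomotopic.chain_sub_mem`, and `hurewicz` is well defined; it is multiplicative because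
concatenation only inserts a unit arrow.

For injectivity, choose `G`-paths `b x` from `x₀` to every `x`. They close any `G`-path up to a
loop, whose class `loopValue` in the abelianized group is additive under gluing. Its linear
extension `chainValue` sends the chain of a loop back to the class of that loop (`chainValue_chain`,
`loopValue_loop`) and vanishes on boundaries (`chainValue_eq_zero`), as is checked in bidegrees
(0,2), (1,1) and (2,0). Singular simplices are merely continuous while `G`-paths are piecewise
smooth; `isSmoothable` bridges the gap, and the choice of smoothing is irrelevant because
deformations need only be continuous.

For surjectivity, adding to a 1-chain the cone over its differential closes every generator up to a
loop (`mem_loopChains`); on a cycle the correction is zero. -/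

noncomputable section

/-! ### Smoothing of paths -/

section Smoothing

variable {E : Type*} [NormedAddCommGroup E] [NormedSpace ℝ E]
  {M : Type*} [TopologicalSpace M] [ChartedSpace E M]

variable (E) in
/-- A path is smoothable if it is homotopic, relative to the end points, to a piecewise smooth
path. -/
def IsSmoothable {x y : M} (γ : Path x y) : Prop :=
  ∃ γ' : PSPath E x y, γ.Homotopic γ'.1

theorem IsSmoothable.congr {x y x' y' : M} {γ : Path x y} {γ' : Path x' y'}
    (h : IsSmoothable E γ) (hγ : ∀ r, γ r = γ' r) : IsSmoothable E γ' := by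
  obtain rfl : x = x' := by rw [← γ.source, hγ, γ'.source]
  obtain rfl : y = y' := by rw [← γ.target, hγ, γ'.target]
  obtain rfl : γ = γ' := Path.ext (funext hγ)
  exact h

theorem IsSmoothable.of_homotopic {x y : M} {γ γ' : Path x y} (h : IsSmoothable E γ)
    (hγ : γ'.Homotopic γ) : IsSmoothable E γ' :=
  h.imp fun _ h' => hγ.trans h'

theorem IsSmoothable.trans {x y z : M} {γ : Path x y} {γ' : Path y z}
    (h : IsSmoothable E γ) (h' : IsSmoothable E γ') : IsSmoothable E (γ.trans γ') := by
  obtain ⟨p, hp⟩ := h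
  obtain ⟨p', hp'⟩ := h'
  exact ⟨p.trans p', hp.hcomp hp'⟩

/-- A path which is the image of a path in a convex set under a smooth map is smoothable: it is
homotopic to the image of a segment. -/
theorem IsSmoothable.map_of_convex {V : Set E} (hV : Convex ℝ V) {φ : E → M}
    (hφ : ContMDiffOn 𝓘(ℝ, E) 𝓘(ℝ, E) ∞ φ V) {a b : V} (p : Path a b) :
    IsSmoothable E (p.map (f := fun v : V => φ v) hφ.continuousOn.domRestrict) := by
  have hline : ∀ r : unitInterval, AffineMap.lineMap (a : E) (b : E) (r : ℝ) ∈ V := fun r =>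
    hV.lineMap_mem a.2 b.2 r.2
  let q : Path a b :=
    { toFun := fun r => ⟨AffineMap.lineMap (a : E) (b : E) (r : ℝ), hline r⟩
      continuous_toFun := by
        refine Continuous.subtype_mk ?_ _
        exact (AffineMap.lineMap_continuous).comp continuous_subtype_val
      source' := Subtype.ext (by simp)
      target' := Subtype.ext (by simp) }
  have : ContractibleSpace V := hV.contractibleSpace ⟨a, a.2⟩
  have hq : IsPiecewiseSmooth E (q.map (f := fun v : V => φ v) hφ.continuousOn.domRestrict) := by
    refine ⟨∅, fun c d hc _ hd _ => ?_⟩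
    have h1 : ContMDiffOn 𝓘(ℝ, ℝ) 𝓘(ℝ, E) ∞
        (φ ∘ fun r : ℝ => AffineMap.lineMap (a : E) (b : E) r) (Set.Icc c d) := by
      refine hφ.comp ?_ fun r hr => hline ⟨r, hc.trans hr.1, hr.2.trans hd⟩
      have h2 : ContDiff ℝ ∞ fun r : ℝ => AffineMap.lineMap (a : E) (b : E) r := by
        simp only [AffineMap.lineMap_apply_module]
        fun_prop
      exact h2.contMDiff.contMDiffOn
    refine h1.congr fun r hr => ?_
    rw [Path.extend_apply _ ⟨hc.trans hr.1, hr.2.trans hd⟩]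
    rfl
  -- The homotopy from `p` to the segment `q` lives in `V`, which is contractible, and is then
  -- pushed forward by `φ`.
  exact ⟨⟨_, hq⟩, (SimplyConnectedSpace.paths_homotopic p q).map
    ⟨fun v : V => φ v, hφ.continuousOn.domRestrict⟩⟩

/-- A path inside a convex part of a chart is smoothable. -/
theorem IsSmoothable.of_mem_chart [IsManifold 𝓘(ℝ, E) ∞ M] {x y : M} (γ : Path x y) (z : M)
    {V : Set E} (hV : Convex ℝ V) (hVt : V ⊆ (chartAt E z).target)
    (hs : ∀ r, γ r ∈ (chartAt E z).source) (hγ : ∀ r, chartAt E z (γ r) ∈ V) :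
    IsSmoothable E γ := by
  let p : Path (⟨_, hγ 0⟩ : V) ⟨_, hγ 1⟩ :=
    { toFun := fun r => ⟨_, hγ r⟩
      continuous_toFun := Continuous.subtype_mk
        ((chartAt E z).continuousOn.comp_continuous γ.continuous hs) _
      source' := rfl
      target' := rfl }
  have hφ : ContMDiffOn 𝓘(ℝ, E) 𝓘(ℝ, E) ∞ (chartAt E z).symm V :=
    (contMDiffOn_chart_symm (I := 𝓘(ℝ, E)) (n := ∞) (x := z)).mono hVt
  exact (IsSmoothable.map_of_convex hV hφ p).congr fun r => (chartAt E z).left_inv (hs r)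

/-- Every continuous path in a manifold is homotopic to a piecewise smooth path. -/
theorem isSmoothable [IsManifold 𝓘(ℝ, E) ∞ M] {x y : M} (γ : Path x y) : IsSmoothable E γ := by
  have hball : ∀ z : M, ∃ ε > 0, Metric.ball (chartAt E z z) ε ⊆ (chartAt E z).target := fun z =>
    Metric.isOpen_iff.1 (chartAt E z).open_target _ (mem_chart_target E z)
  choose ε hε hεt using hball
  let U : M → Set M := fun z =>
    (chartAt E z).source ∩ chartAt E z ⁻¹' Metric.ball (chartAt E z z) (ε z)
  have hU : ∀ z, IsOpen (U z) := fun z => (chartAt E z).isOpen_inter_preimage Metric.isOpen_ball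
  -- Lebesgue subdivision: each piece of the path lies in one `U z`, which the chart maps into a
  -- ball, hence a convex set.
  obtain ⟨t, ht0, htmono, ⟨n, hn⟩, htU⟩ :=
    exists_monotone_Icc_subset_open_cover_unitInterval (c := fun z => γ ⁻¹' U z)
      (fun z => (hU z).preimage γ.continuous)
      (fun r _ => Set.mem_iUnion.2 ⟨γ r, mem_chart_source E _, Metric.mem_ball_self (hε _)⟩)
  -- The initial segments grow by one subdivision piece at a time; from index `n` on, `t` is 1 and
  -- the segment is all of `γ`.
  have key : ∀ k, IsSmoothable E (γ.subpath 0 (t k)) := by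
    intro k
    induction k with
    | zero =>
      refine IsSmoothable.congr (γ := Path.refl (γ 0)) ⟨PSPath.refl _, .refl _⟩ fun r => ?_
      rw [ht0, Path.subpath_self]
    | succ k ih =>
      obtain ⟨z, hz⟩ := htU k
      have hr : ∀ r, γ.subpath (t k) (t (k + 1)) r ∈ U z := fun r => by
        have h1 : γ.subpath (t k) (t (k + 1)) r ∈ Set.range (γ.subpath (t k) (t (k + 1))) := ⟨r, rfl⟩
        rw [Path.range_subpath_of_le _ _ _ (htmono k.le_succ)] at h1
        obtain ⟨w, hw, hw'⟩ := h1
        rw [← hw']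
        exact hz hw
      exact (ih.trans (IsSmoothable.of_mem_chart _ z (convex_ball _ _) (hεt z) (fun r => (hr r).1)
        fun r => (hr r).2)).of_homotopic ⟨(Path.Homotopy.subpathTransSubpath γ _ _ _).symm⟩
  refine (key n).congr fun r => ?_
  rw [hn n le_rfl, Path.subpath_zero_one]
  rfl

end Smoothing

/-! ### Elementary total boundaries -/

theorem LieGroupoid.simplexFace_apply_succAbove (q : ℕ) (j : Fin (q + 2))
    (p : stdSimplex ℝ (Fin (q + 1))) (i : Fin (q + 1)) :
    (LieGroupoid.simplexFace q j p).1 (j.succAbove i) = p.1 i := by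
  change FunOnFinite.linearMap ℝ ℝ j.succAbove p.1 _ = _
  rw [FunOnFinite.linearMap_apply_apply]
  simp [Finset.sum_filter]

theorem LieGroupoid.simplexFace_apply_self (q : ℕ) (j : Fin (q + 2))
    (p : stdSimplex ℝ (Fin (q + 1))) :
    (LieGroupoid.simplexFace q j p).1 j = 0 := by
  change FunOnFinite.linearMap ℝ ℝ j.succAbove p.1 _ = _
  rw [FunOnFinite.linearMap_apply_apply]
  simp [Fin.succAbove_ne]

/-- The affine map from the standard `2`-simplex to the square which sends the vertices to
`(0, 0)`, `(1, 0)` and `(1, 1)`. -/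
def simplexToSquare : C(stdSimplex ℝ (Fin 3), unitInterval × unitInterval) where
  toFun p := (⟨p.1 1 + p.1 2, add_nonneg (p.2.1 1) (p.2.1 2), by
      have h1 := p.2.2
      rw [Fin.sum_univ_three] at h1
      linarith [p.2.1 0]⟩,
    ⟨p.1 2, p.2.1 2, by
      have h1 := p.2.2
      rw [Fin.sum_univ_three] at h1
      linarith [p.2.1 0, p.2.1 1]⟩)
  continuous_toFun := by
    have hc : ∀ i : Fin 3, Continuous fun p : stdSimplex ℝ (Fin 3) => p.1 i := fun i =>
      (continuous_apply i).comp continuous_subtype_val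
    exact (((hc 1).add (hc 2)).subtype_mk _).prodMk ((hc 2).subtype_mk _)

/-- `stdSimplexHomeomorphUnitInterval` reads off the barycentric coordinate of vertex 1. The three
faces are thus the right side, the diagonal and the bottom side of the square, each run at unit
speed in the parameter. -/
theorem simplexToSquare_face_zero (p : stdSimplex ℝ (Fin 2)) :
    simplexToSquare (LieGroupoid.simplexFace 1 0 p) = (1, stdSimplexHomeomorphUnitInterval p) := by
  have h1 := p.2.2
  rw [Fin.sum_univ_two] at h1
  have e1 : (LieGroupoid.simplexFace 1 0 p).1 1 = p.1 0 :=
    LieGroupoid.simplexFace_apply_succAbove 1 0 p 0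
  have e2 : (LieGroupoid.simplexFace 1 0 p).1 2 = p.1 1 :=
    LieGroupoid.simplexFace_apply_succAbove 1 0 p 1
  refine Prod.ext (Subtype.ext ?_) (Subtype.ext e2)
  exact (congrArg₂ (· + ·) e1 e2).trans h1

theorem simplexToSquare_face_one (p : stdSimplex ℝ (Fin 2)) :
    simplexToSquare (LieGroupoid.simplexFace 1 1 p) =
      (stdSimplexHomeomorphUnitInterval p, stdSimplexHomeomorphUnitInterval p) := by
  have e1 : (LieGroupoid.simplexFace 1 1 p).1 1 = 0 := LieGroupoid.simplexFace_apply_self 1 1 p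
  have e2 : (LieGroupoid.simplexFace 1 1 p).1 2 = p.1 1 :=
    LieGroupoid.simplexFace_apply_succAbove 1 1 p 1
  refine Prod.ext (Subtype.ext ?_) (Subtype.ext e2)
  exact (congrArg₂ (· + ·) e1 e2).trans (zero_add _)

theorem simplexToSquare_face_two (p : stdSimplex ℝ (Fin 2)) :
    simplexToSquare (LieGroupoid.simplexFace 1 2 p) = (stdSimplexHomeomorphUnitInterval p, 0) := by
  have e1 : (LieGroupoid.simplexFace 1 2 p).1 1 = p.1 1 :=
    LieGroupoid.simplexFace_apply_succAbove 1 2 p 1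
  have e2 : (LieGroupoid.simplexFace 1 2 p).1 2 = 0 := LieGroupoid.simplexFace_apply_self 1 2 p
  refine Prod.ext (Subtype.ext ?_) (Subtype.ext e2)
  exact (congrArg₂ (· + ·) e1 e2).trans (add_zero _)

namespace LieGroupoid

variable {EM EG : Type*} {M G : Type u}
  [NormedAddCommGroup EM] [NormedSpace ℝ EM] [NormedAddCommGroup EG] [NormedSpace ℝ EG]
  [TopologicalSpace M] [ChartedSpace EM M] [TopologicalSpace G] [ChartedSpace EG G]
  (𝒢 : LieGroupoid EM EG M G)

/-- A map `[0,1] → M` as a `1`-simplex of `G⁽⁰⁾`. -/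
def edgeSimplex (f : C(unitInterval, M)) : 𝒢.Simplex 1 0 :=
  (f.comp ⟨stdSimplexHomeomorphUnitInterval, stdSimplexHomeomorphUnitInterval.continuous⟩ :
    C(stdSimplex ℝ (Fin 2), M))

/-- A map `[0,1] → G` as a `1`-simplex of `G⁽¹⁾`. -/
def arrowEdgeSimplex (d : C(unitInterval, G)) : 𝒢.Simplex 1 1 :=
  (⟨fun p => ⟨fun _ => d (stdSimplexHomeomorphUnitInterval p), fun j => j.elim0⟩,
    (continuous_pi fun _ => d.continuous.comp
      stdSimplexHomeomorphUnitInterval.continuous).subtype_mk _⟩ :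
    C(stdSimplex ℝ (Fin 2), {g : Fin 1 → G // ∀ j : Fin 0, 𝒢.s (g j.castSucc) = 𝒢.t (g j.succ)}))

/-- A composable pair as a `0`-simplex of `G⁽²⁾`. -/
def pairSimplex (g h : G) (hgh : 𝒢.s g = 𝒢.t h) : 𝒢.Simplex 0 2 :=
  ContinuousMap.const _ (show 𝒢.Nerve 2 from ⟨![g, h], fun j => by
    rw [Subsingleton.elim j 0]; exact hgh⟩)

/-- This normal form and the three after it reduce statements about arbitrary generators to paths,
paths of arrows, arrows and composable pairs. -/
theorem exists_eq_edgeSimplex (σ : 𝒢.Simplex 1 0) :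
    ∃ f : C(unitInterval, M), σ = 𝒢.edgeSimplex f :=
  ⟨ContinuousMap.comp (show C(stdSimplex ℝ (Fin 2), M) from σ)
      ⟨stdSimplexHomeomorphUnitInterval.symm, stdSimplexHomeomorphUnitInterval.symm.continuous⟩,
    ContinuousMap.ext fun p =>
      congrArg σ (stdSimplexHomeomorphUnitInterval.symm_apply_apply p).symm⟩

theorem exists_eq_arrowEdgeSimplex (σ : 𝒢.Simplex 1 1) :
    ∃ d : C(unitInterval, G), σ = 𝒢.arrowEdgeSimplex d := by
  have hc : Continuous fun p : stdSimplex ℝ (Fin 2) => (σ p).1 0 :=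
    (continuous_apply 0).comp (continuous_subtype_val.comp σ.continuous)
  refine ⟨⟨fun r => (σ (stdSimplexHomeomorphUnitInterval.symm r)).1 0,
    hc.comp stdSimplexHomeomorphUnitInterval.symm.continuous⟩,
    ContinuousMap.ext fun p => Subtype.ext (funext fun i => ?_)⟩
  obtain rfl : i = 0 := Subsingleton.elim (α := Fin 1) i 0
  exact congrArg (fun p => (σ p).1 0) (stdSimplexHomeomorphUnitInterval.symm_apply_apply p).symm

theorem exists_eq_arrowSimplex (σ : 𝒢.Simplex 0 1) : ∃ g : G, σ = arrowSimplex g := by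
  refine ⟨(σ default).1 0, ContinuousMap.ext fun p => Subtype.ext (funext fun i => ?_)⟩
  obtain rfl : i = 0 := Subsingleton.elim (α := Fin 1) i 0
  rw [Subsingleton.elim p default]
  rfl

theorem exists_eq_pairSimplex (σ : 𝒢.Simplex 0 2) :
    ∃ (g h : G) (hgh : 𝒢.s g = 𝒢.t h), σ = 𝒢.pairSimplex g h hgh := by
  refine ⟨(σ default).1 0, (σ default).1 1, (σ default).2 0,
    ContinuousMap.ext fun p => Subtype.ext (funext fun i => ?_)⟩
  rw [Subsingleton.elim p default]
  revert i
  exact Fin.forall_fin_two.2 ⟨rfl, rfl⟩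

/-- The chain of a map `[0,1] → M`. -/
def edgeChain (f : C(unitInterval, M)) : 𝒢.Chains := Finsupp.single ⟨1, 0, 𝒢.edgeSimplex f⟩ 1

/-- The chain of an arrow. -/
def arrowChain (g : G) : 𝒢.Chains := Finsupp.single ⟨0, 1, arrowSimplex g⟩ 1

theorem totalDifferential_single (b : 𝒢.BiSimplex) :
    𝒢.totalDifferential (Finsupp.single b 1) =
      (-1 : ℤ) ^ (b.1 + b.2.1) • 𝒢.nerveBoundary b.1 b.2.1 b.2.2 +
        (-1 : ℤ) ^ b.1 • 𝒢.singularBoundary b.1 b.2.1 b.2.2 := by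
  rw [totalDifferential, Finsupp.linearCombination_single, one_smul]

theorem totalDifferential_triangle (T : 𝒢.Simplex 2 0) :
    𝒢.totalDifferential (Finsupp.single ⟨2, 0, T⟩ 1) =
      Finsupp.single ⟨1, 0, T.comp (simplexFace 1 0)⟩ 1 -
        Finsupp.single ⟨1, 0, T.comp (simplexFace 1 1)⟩ 1 +
          Finsupp.single ⟨1, 0, T.comp (simplexFace 1 2)⟩ 1 := by
  have hs : 𝒢.singularBoundary 2 0 T =
      Finsupp.single ⟨1, 0, T.comp (simplexFace 1 0)⟩ 1 -
        Finsupp.single ⟨1, 0, T.comp (simplexFace 1 1)⟩ 1 +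
          Finsupp.single ⟨1, 0, T.comp (simplexFace 1 2)⟩ 1 := by
    refine (Fin.sum_univ_three _).trans ?_
    rw [sub_eq_add_neg, ← Finsupp.single_neg]
    rfl
  rw [totalDifferential_single]
  change (-1 : ℤ) ^ (2 + 0) • (0 : 𝒢.Chains) + (-1 : ℤ) ^ 2 • 𝒢.singularBoundary 2 0 T = _
  rw [hs]
  simp

theorem totalDifferential_arrowEdge (d : C(unitInterval, G)) :
    𝒢.totalDifferential (Finsupp.single ⟨1, 1, 𝒢.arrowEdgeSimplex d⟩ 1) =
      𝒢.edgeChain ⟨fun r => 𝒢.t (d r), 𝒢.continuous_t.comp d.continuous⟩ -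
        𝒢.edgeChain ⟨fun r => 𝒢.s (d r), 𝒢.continuous_s.comp d.continuous⟩ -
          𝒢.arrowChain (d 1) + 𝒢.arrowChain (d 0) := by
  have hn : 𝒢.nerveBoundary 1 1 (𝒢.arrowEdgeSimplex d) =
      𝒢.edgeChain ⟨fun r => 𝒢.t (d r), 𝒢.continuous_t.comp d.continuous⟩ -
        𝒢.edgeChain ⟨fun r => 𝒢.s (d r), 𝒢.continuous_s.comp d.continuous⟩ := by
    refine (Fin.sum_univ_two _).trans ?_
    rw [sub_eq_add_neg, edgeChain, edgeChain, ← Finsupp.single_neg]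
    rfl
  -- Face 0 omits vertex 0, so it sits at parameter 1, and conversely.
  have key : ∀ j : Fin 2, ∀ p : stdSimplex ℝ (Fin 1),
      stdSimplexHomeomorphUnitInterval (simplexFace 0 j p) = if j = 0 then 1 else 0 := by
    intro j p
    have hp : p = ⟨_, single_mem_stdSimplex ℝ 0⟩ := Subsingleton.elim _ _
    rw [hp]
    fin_cases j
    · exact congrArg stdSimplexHomeomorphUnitInterval
        (stdSimplex.map_vertex (S := ℝ) (Fin.succAbove (0 : Fin 2)) 0)
    · exact congrArg stdSimplexHomeomorphUnitInterval
        (stdSimplex.map_vertex (S := ℝ) (Fin.succAbove (1 : Fin 2)) 0)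
  have h0 : (𝒢.arrowEdgeSimplex d).comp (simplexFace 0 0) = arrowSimplex (d 1) :=
    ContinuousMap.ext fun p => Subtype.ext (funext fun _ => congrArg d (key 0 p))
  have h1 : (𝒢.arrowEdgeSimplex d).comp (simplexFace 0 1) = arrowSimplex (d 0) :=
    ContinuousMap.ext fun p => Subtype.ext (funext fun _ => congrArg d (key 1 p))
  have hs : 𝒢.singularBoundary 1 1 (𝒢.arrowEdgeSimplex d) =
      𝒢.arrowChain (d 1) - 𝒢.arrowChain (d 0) := by
    refine (Fin.sum_univ_two _).trans ?_
    rw [h0, h1, sub_eq_add_neg, arrowChain, arrowChain, ← Finsupp.single_neg]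
    rfl
  rw [totalDifferential_single]
  change (-1 : ℤ) ^ (1 + 1) • 𝒢.nerveBoundary 1 1 (𝒢.arrowEdgeSimplex d) +
    (-1 : ℤ) ^ 1 • 𝒢.singularBoundary 1 1 (𝒢.arrowEdgeSimplex d) = _
  rw [hs, hn]
  simp only [Int.reduceNeg, Nat.reduceAdd, even_two, Even.neg_pow, one_pow, one_smul, pow_one,
    neg_smul]
  abel

/-- The nerve faces of `(g, h)` are `h`, the product and `g`; a 0-simplex contributes no singular
boundary. -/
theorem totalDifferential_pair (g h : G) (hgh : 𝒢.s g = 𝒢.t h) :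
    𝒢.totalDifferential (Finsupp.single ⟨0, 2, 𝒢.pairSimplex g h hgh⟩ 1) =
      𝒢.arrowChain h - 𝒢.arrowChain (𝒢.comp g h) + 𝒢.arrowChain g := by
  have hf : ∀ (k : Fin 3) (f : G), 𝒢.faceArrow k ![g, h] 0 = f →
      (𝒢.nerveFace 1 k).comp (𝒢.pairSimplex g h hgh) = arrowSimplex f := fun k f hk =>
    ContinuousMap.ext fun p => Subtype.ext (funext fun i => by
      obtain rfl : i = 0 := Subsingleton.elim (α := Fin 1) i 0
      exact hk)
  have hn : 𝒢.nerveBoundary 0 2 (𝒢.pairSimplex g h hgh) =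
      𝒢.arrowChain h - 𝒢.arrowChain (𝒢.comp g h) + 𝒢.arrowChain g := by
    refine (Fin.sum_univ_three _).trans ?_
    rw [hf 0 h (by simp [faceArrow]), hf 1 (𝒢.comp g h) (by simp [faceArrow]),
      hf 2 g (by simp [faceArrow]), sub_eq_add_neg, arrowChain, arrowChain, arrowChain,
      ← Finsupp.single_neg]
    rfl
  rw [totalDifferential_single]
  change (-1 : ℤ) ^ (0 + 2) • 𝒢.nerveBoundary 0 2 (𝒢.pairSimplex g h hgh) +
    (-1 : ℤ) ^ 0 • (0 : 𝒢.Chains) = _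
  rw [hn]
  simp

theorem totalDifferential_mem_boundaries {b : 𝒢.BiSimplex} {v : ℕ} (hb : b.1 + b.2.1 = v + 1) :
    𝒢.totalDifferential (Finsupp.single b 1) ∈ 𝒢.totalBoundaries v :=
  Submodule.mem_map_of_mem (Finsupp.single_mem_supported ℤ _ hb)

/-- The two halves of a square give homologous chains. -/
theorem triangle_mem_boundaries (D : C(unitInterval × unitInterval, M)) :
    𝒢.edgeChain ⟨fun r => D (1, r), by fun_prop⟩ - 𝒢.edgeChain ⟨fun r => D (r, r), by fun_prop⟩ +
      𝒢.edgeChain ⟨fun r => D (r, 0), by fun_prop⟩ ∈ 𝒢.totalBoundaries 1 := by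
  let T : 𝒢.Simplex 2 0 := (D.comp simplexToSquare : C(stdSimplex ℝ (Fin 3), M))
  have h := 𝒢.totalDifferential_mem_boundaries (b := ⟨2, 0, T⟩) (v := 1) rfl
  rw [totalDifferential_triangle] at h
  have h0 : T.comp (simplexFace 1 0) = 𝒢.edgeSimplex ⟨fun r => D (1, r), by fun_prop⟩ :=
    ContinuousMap.ext fun p => congrArg D (simplexToSquare_face_zero p)
  have h1 : T.comp (simplexFace 1 1) = 𝒢.edgeSimplex ⟨fun r => D (r, r), by fun_prop⟩ :=
    ContinuousMap.ext fun p => congrArg D (simplexToSquare_face_one p)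
  have h2 : T.comp (simplexFace 1 2) = 𝒢.edgeSimplex ⟨fun r => D (r, 0), by fun_prop⟩ :=
    ContinuousMap.ext fun p => congrArg D (simplexToSquare_face_two p)
  rw [h0, h1, h2] at h
  exact h

/-- The diagonal cuts the square into two triangles. The second is the first with the coordinates of
`D` swapped, and the diagonals cancel in the difference. -/
theorem square_mem_boundaries (D : C(unitInterval × unitInterval, M)) :
    𝒢.edgeChain ⟨fun r => D (r, 0), by fun_prop⟩ + 𝒢.edgeChain ⟨fun r => D (1, r), by fun_prop⟩ -
      𝒢.edgeChain ⟨fun r => D (0, r), by fun_prop⟩ -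
        𝒢.edgeChain ⟨fun r => D (r, 1), by fun_prop⟩ ∈ 𝒢.totalBoundaries 1 := by
  have h := sub_mem (𝒢.triangle_mem_boundaries D)
    (𝒢.triangle_mem_boundaries (D.comp ⟨fun p => (p.2, p.1), by fun_prop⟩))
  simp only [ContinuousMap.comp_apply, ContinuousMap.coe_mk] at h
  convert h using 1
  abel

/-- A constant triangle has three equal faces, two of which cancel. The same trick with the pair of
units handles `arrowChain_unit_mem`. -/
theorem edgeChain_const_mem (x : M) :
    𝒢.edgeChain (ContinuousMap.const _ x) ∈ 𝒢.totalBoundaries 1 := by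
  have h : 𝒢.edgeChain (ContinuousMap.const _ x) - 𝒢.edgeChain (ContinuousMap.const _ x) +
      𝒢.edgeChain (ContinuousMap.const _ x) ∈ 𝒢.totalBoundaries 1 :=
    𝒢.triangle_mem_boundaries (ContinuousMap.const _ x)
  rwa [sub_self, zero_add] at h

theorem arrowChain_unit_mem (x : M) : 𝒢.arrowChain (𝒢.unit x) ∈ 𝒢.totalBoundaries 1 := by
  have hx : 𝒢.s (𝒢.unit x) = 𝒢.t (𝒢.unit x) := (𝒢.s_unit x).trans (𝒢.t_unit x).symm
  have h := 𝒢.totalDifferential_mem_boundaries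
    (b := ⟨0, 2, 𝒢.pairSimplex (𝒢.unit x) (𝒢.unit x) hx⟩) (v := 1) rfl
  have hc := 𝒢.unit_comp (𝒢.unit x)
  rw [𝒢.t_unit] at hc
  rw [totalDifferential_pair, hc, sub_self, zero_add] at h
  exact h

theorem arrowChain_comp_mem (g h : G) (hgh : 𝒢.s g = 𝒢.t h) :
    𝒢.arrowChain h - 𝒢.arrowChain (𝒢.comp g h) + 𝒢.arrowChain g ∈ 𝒢.totalBoundaries 1 := by
  rw [← 𝒢.totalDifferential_pair g h hgh]
  exact 𝒢.totalDifferential_mem_boundaries rfl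

theorem arrowEdge_mem_boundaries (d : C(unitInterval, G)) :
    𝒢.edgeChain ⟨fun r => 𝒢.t (d r), 𝒢.continuous_t.comp d.continuous⟩ -
      𝒢.edgeChain ⟨fun r => 𝒢.s (d r), 𝒢.continuous_s.comp d.continuous⟩ -
        𝒢.arrowChain (d 1) + 𝒢.arrowChain (d 0) ∈ 𝒢.totalBoundaries 1 := by
  rw [← 𝒢.totalDifferential_arrowEdge d]
  exact 𝒢.totalDifferential_mem_boundaries rfl

theorem edgeChain_trans_mem {x y z : M} (γ : Path x y) (γ' : Path y z) :
    𝒢.edgeChain γ'.toContinuousMap - 𝒢.edgeChain (γ.trans γ').toContinuousMap +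
      𝒢.edgeChain γ.toContinuousMap ∈ 𝒢.totalBoundaries 1 := by
  -- Averaging the coordinates makes the diagonal run through the whole concatenation, the bottom
  -- side through its first half and the right side through its second half.
  have h := 𝒢.triangle_mem_boundaries
    ⟨fun p => (γ.trans γ').extend (((p.1 : ℝ) + p.2) / 2), by fun_prop⟩
  convert h using 3
  · congr 1
    ext r
    have hr := r.2
    change γ' r = (γ.trans γ').extend ((1 + (r : ℝ)) / 2)
    rw [Path.extend_trans_of_half_le _ _ (by linarith [hr.1])]
    rw [show 2 * ((1 + (r : ℝ)) / 2) - 1 = r by ring, Path.extend_apply _ hr]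
  · congr 1
    ext r
    change (γ.trans γ') r = (γ.trans γ').extend (((r : ℝ) + r) / 2)
    rw [show ((r : ℝ) + r) / 2 = r by ring, Path.extend_apply _ r.2]
  · ext r
    have hr := r.2
    change γ r = (γ.trans γ').extend (((r : ℝ) + 0) / 2)
    rw [Path.extend_trans_of_le_half _ _ (by linarith [hr.2])]
    rw [show 2 * (((r : ℝ) + 0) / 2) = r by ring, Path.extend_apply _ hr]

theorem edgeChain_homotopic_mem {x y : M} {γ γ' : Path x y} (h : γ.Homotopic γ') :
    𝒢.edgeChain γ.toContinuousMap - 𝒢.edgeChain γ'.toContinuousMap ∈ 𝒢.totalBoundaries 1 := by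
  obtain ⟨F⟩ := h
  have h1 := 𝒢.square_mem_boundaries F.toContinuousMap
  have e0 : (⟨fun r => F.toContinuousMap (r, 0), by fun_prop⟩ : C(unitInterval, M)) =
      ContinuousMap.const _ x := ContinuousMap.ext fun r => F.source r
  have e1 : (⟨fun r => F.toContinuousMap (r, 1), by fun_prop⟩ : C(unitInterval, M)) =
      ContinuousMap.const _ y := ContinuousMap.ext fun r => F.target r
  have e2 : (⟨fun r => F.toContinuousMap (0, r), by fun_prop⟩ : C(unitInterval, M)) =
      γ.toContinuousMap := ContinuousMap.ext fun r => F.apply_zero r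
  have e3 : (⟨fun r => F.toContinuousMap (1, r), by fun_prop⟩ : C(unitInterval, M)) =
      γ'.toContinuousMap := ContinuousMap.ext fun r => F.apply_one r
  rw [e0, e1, e2, e3] at h1
  have h2 := sub_mem (sub_mem (𝒢.edgeChain_const_mem x) h1) (𝒢.edgeChain_const_mem y)
  convert h2 using 1
  abel

/-! ### Homology classes of `G`-paths and the Hurewicz homomorphism -/

variable {𝒢}

namespace GPath

theorem chain_single {x y : M} (γ : PSPath EM x y) :
    (single γ : 𝒢.GPath x y).chain = 𝒢.edgeChain γ.1.toContinuousMap := rfl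

theorem chain_cons {x a b y : M} (γ : PSPath EM x a) (g : 𝒢.Arrow a b) (ρ : 𝒢.GPath b y) :
    (cons γ g ρ).chain = 𝒢.edgeChain γ.1.toContinuousMap + 𝒢.arrowChain g.1 + ρ.chain := rfl

theorem chain_glue {x a b y : M} (σ : 𝒢.GPath x a) (g : 𝒢.Arrow a b) (τ : 𝒢.GPath b y) :
    (glue σ g τ).chain = σ.chain + 𝒢.arrowChain g.1 + τ.chain := by
  induction σ with
  | single γ => rfl
  | cons γ h ρ ih =>
    change 𝒢.edgeChain γ.1.toContinuousMap + 𝒢.arrowChain h.1 + (glue ρ g τ).chain = _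
    rw [ih, chain_cons]
    abel

theorem chain_concat_mem {x y z : M} (σ : 𝒢.GPath x y) (τ : 𝒢.GPath y z) :
    (concat σ τ).chain - (σ.chain + τ.chain) ∈ 𝒢.totalBoundaries 1 := by
  convert 𝒢.arrowChain_unit_mem y using 1
  rw [concat, chain_glue]
  change σ.chain + 𝒢.arrowChain (𝒢.unit y) + τ.chain - _ = _
  abel

theorem Step.chain_sub_mem {x y : M} {σ σ' : 𝒢.GPath x y} (h : Step σ σ') :
    σ.chain - σ'.chain ∈ 𝒢.totalBoundaries 1 := by
  induction h with
  | mul γ g h ρ =>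
    rename_i b _ _
    convert add_mem (𝒢.arrowChain_comp_mem h.1 g.1 (h.2.1.trans g.2.2.symm))
      (𝒢.edgeChain_const_mem b) using 1
    change 𝒢.edgeChain γ.1.toContinuousMap + 𝒢.arrowChain g.1 +
      (𝒢.edgeChain (ContinuousMap.const _ b) + 𝒢.arrowChain h.1 + ρ.chain) -
      (𝒢.edgeChain γ.1.toContinuousMap + 𝒢.arrowChain (𝒢.comp h.1 g.1) + ρ.chain) = _
    abel
  | concat_single γ γ' =>
    rename_i a _
    convert add_mem (𝒢.edgeChain_trans_mem γ.1 γ'.1) (𝒢.arrowChain_unit_mem a) using 1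
    change 𝒢.edgeChain γ.1.toContinuousMap + 𝒢.arrowChain (𝒢.unit a) +
      𝒢.edgeChain γ'.1.toContinuousMap - 𝒢.edgeChain (γ.1.trans γ'.1).toContinuousMap = _
    abel
  | concat_cons γ γ' g ρ =>
    rename_i a _ _ _
    convert add_mem (𝒢.edgeChain_trans_mem γ.1 γ'.1) (𝒢.arrowChain_unit_mem a) using 1
    change 𝒢.edgeChain γ.1.toContinuousMap + 𝒢.arrowChain (𝒢.unit a) +
      (𝒢.edgeChain γ'.1.toContinuousMap + 𝒢.arrowChain g.1 + ρ.chain) -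
      (𝒢.edgeChain (γ.1.trans γ'.1).toContinuousMap + 𝒢.arrowChain g.1 + ρ.chain) = _
    abel
  | cons γ g _ ih =>
    rw [chain_cons, chain_cons, add_sub_add_left_eq_sub]
    exact ih

/-- The induction needs a moving starting point: `σ` is homologous to the trace `P` of that point
followed by `σ'`. For `cons`, the square `D` and the strip `d` share the edge `s ∘ d`, while `t ∘ d`
is the trace belonging to the tail. -/
theorem Deform.chain_sub_mem {x x' y : M} {p : unitInterval → M} {σ : 𝒢.GPath x y}
    {σ' : 𝒢.GPath x' y} (h : Deform p σ σ') :
    ∃ P : C(unitInterval, M), (∀ τ, P τ = p τ) ∧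
      σ.chain - 𝒢.edgeChain P - σ'.chain ∈ 𝒢.totalBoundaries 1 := by
  induction h with
  | single D h₀ h₁ h₂ =>
    rename_i y γ γ'
    refine ⟨⟨fun τ => D (τ, 0), by fun_prop⟩, fun _ => by rfl, ?_⟩
    have e0 : (⟨fun r => D (0, r), by fun_prop⟩ : C(unitInterval, M)) = γ.1.toContinuousMap :=
      ContinuousMap.ext h₀
    have e1 : (⟨fun r => D (1, r), by fun_prop⟩ : C(unitInterval, M)) = γ'.1.toContinuousMap :=
      ContinuousMap.ext h₁
    have e2 : (⟨fun r => D (r, 1), by fun_prop⟩ : C(unitInterval, M)) = ContinuousMap.const _ y :=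
      ContinuousMap.ext h₂
    have h1 := 𝒢.square_mem_boundaries D
    rw [e0, e1, e2] at h1
    convert neg_mem (add_mem h1 (𝒢.edgeChain_const_mem y)) using 1
    rw [chain_single, chain_single]
    abel
  | cons D d h₀ h₁ d₀ d₁ hs _ ih =>
    rename_i γ γ' g g' ρ ρ' _
    refine ⟨⟨fun τ => D (τ, 0), by fun_prop⟩, fun _ => by rfl, ?_⟩
    obtain ⟨Q, hQ, ih⟩ := ih
    have e0 : (⟨fun r => D (0, r), by fun_prop⟩ : C(unitInterval, M)) = γ.1.toContinuousMap :=
      ContinuousMap.ext h₀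
    have e1 : (⟨fun r => D (1, r), by fun_prop⟩ : C(unitInterval, M)) = γ'.1.toContinuousMap :=
      ContinuousMap.ext h₁
    have e2 : (⟨fun r => 𝒢.s (d r), 𝒢.continuous_s.comp d.continuous⟩ : C(unitInterval, M)) =
      ⟨fun r => D (r, 1), by fun_prop⟩ := ContinuousMap.ext hs
    have e3 : (⟨fun r => 𝒢.t (d r), 𝒢.continuous_t.comp d.continuous⟩ : C(unitInterval, M)) = Q :=
      ContinuousMap.ext fun r => (hQ r).symm
    have h1 := 𝒢.square_mem_boundaries D
    have h2 := 𝒢.arrowEdge_mem_boundaries d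
    rw [e0, e1] at h1
    rw [e2, e3, d₀, d₁] at h2
    convert add_mem (sub_mem h2 h1) ih using 1
    rw [chain_cons, chain_cons]
    abel

/-- `G`-homotopic `G`-paths have homologous chains. -/
theorem GHomotopic.chain_sub_mem {x y : M} {σ σ' : 𝒢.GPath x y} (h : GHomotopic σ σ') :
    σ.chain - σ'.chain ∈ 𝒢.totalBoundaries 1 := by
  induction h with
  | rel _ _ h =>
    rcases h with h | h
    · exact h.chain_sub_mem
    · obtain ⟨P, hP, h1⟩ := Deform.chain_sub_mem h
      -- With the starting point fixed, the trace is constant and hence a boundary.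
      obtain rfl : P = ContinuousMap.const _ x := ContinuousMap.ext hP
      convert add_mem h1 (𝒢.edgeChain_const_mem x) using 1
      abel
  | refl _ => rw [sub_self]; exact zero_mem _
  | symm _ _ _ ih => rw [← neg_sub]; exact neg_mem ih
  | trans _ _ _ _ _ ih ih' => rw [← sub_add_sub_cancel]; exact add_mem ih ih'

end GPath

theorem loopClass_eq_iff {x₀ : M} (σ σ' : 𝒢.GPath x₀ x₀) :
    loopClass σ = loopClass σ' ↔ σ.chain - σ'.chain ∈ 𝒢.totalBoundaries 1 :=
  Submodule.Quotient.eq _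

/-- The Hurewicz homomorphism. -/
def hurewicz (𝒢 : LieGroupoid EM EG M G) (x₀ : M) :
    𝒢.FundamentalGroup x₀ →* Multiplicative (𝒢.TotalHomology 1) :=
  MonoidHom.mk'
    (fun a => Quotient.liftOn a (fun σ => Multiplicative.ofAdd (loopClass σ)) fun _ _ h =>
      congrArg Multiplicative.ofAdd ((loopClass_eq_iff _ _).2 (GPath.GHomotopic.chain_sub_mem h)))
    (by
      rintro ⟨σ⟩ ⟨τ⟩
      exact congrArg Multiplicative.ofAdd
        ((Submodule.Quotient.eq _).2 (GPath.chain_concat_mem σ τ)))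

theorem hurewicz_homotopyClass {x₀ : M} (σ : 𝒢.GPath x₀ x₀) :
    𝒢.hurewicz x₀ (homotopyClass σ) = Multiplicative.ofAdd (loopClass σ) := rfl

end LieGroupoid

namespace LieGroupoid

variable {EM EG : Type*} {M G : Type u}
  [NormedAddCommGroup EM] [NormedSpace ℝ EM] [NormedAddCommGroup EG] [NormedSpace ℝ EG]
  [TopologicalSpace M] [ChartedSpace EM M] [TopologicalSpace G] [ChartedSpace EG G]
  {𝒢 : LieGroupoid EM EG M G}

/-! ### The inverse of the Hurewicz homomorphism on chains -/

theorem Arrow.id_trans {x y : M} (g : 𝒢.Arrow x y) : (Arrow.id x).trans g = g := by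
  obtain ⟨g, rfl, rfl⟩ := g
  exact Subtype.ext (𝒢.comp_unit g)

theorem Arrow.trans_id {x y : M} (g : 𝒢.Arrow x y) : g.trans (Arrow.id y) = g := by
  obtain ⟨g, rfl, rfl⟩ := g
  exact Subtype.ext (𝒢.unit_comp g)

namespace GPath

theorem concat_assoc {x y z w : M} (α : 𝒢.GPath x y) (β : 𝒢.GPath y z) (τ : 𝒢.GPath z w) :
    concat (concat α β) τ = concat α (concat β τ) := glue_assoc ..

/-- An arrow as a `G`-path. -/
def ofArrow {x y : M} (g : 𝒢.Arrow x y) : 𝒢.GPath x y :=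
  cons (PSPath.refl x) g (single (PSPath.refl y))

/-- The product move absorbs the extra units and constant paths, so an arrow can be split off as a
`G`-path of its own. This is what makes `loopValue` additive over the pieces of a `G`-path. -/
theorem glue_gHomotopic {x a b y : M} (σ : 𝒢.GPath x a) (g : 𝒢.Arrow a b) (τ : 𝒢.GPath b y) :
    GHomotopic (glue σ g τ) (concat (concat σ (ofArrow g)) τ) := by
  rw [concat_assoc]
  have h1 : GHomotopic (concat (ofArrow g) τ) (cons (PSPath.refl a) g τ) := by
    have h := (Step.mul (PSPath.refl a) g (Arrow.id b) τ).gHomotopic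
    rwa [Arrow.trans_id] at h
  have h2 : GHomotopic (concat σ (cons (PSPath.refl a) g τ)) (glue σ g τ) := by
    have h := glue_mul σ (Arrow.id a) g τ
    rwa [Arrow.id_trans] at h
  exact ((h1.glue_right σ (Arrow.id a)).trans h2).symm

/-- The `G`-loop at `x₀` obtained from a `G`-path by means of chosen `G`-paths from `x₀` to all
points. -/
def loopAt {x₀ : M} (b : ∀ x, 𝒢.GPath x₀ x) {x y : M} (ρ : 𝒢.GPath x y) : 𝒢.GPath x₀ x₀ :=
  concat (concat (b x) ρ) (reverse (b y))

theorem loopAt_concat {x₀ : M} (b : ∀ x, 𝒢.GPath x₀ x) {x y z : M} (ρ : 𝒢.GPath x y)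
    (τ : 𝒢.GPath y z) :
    GHomotopic (concat (loopAt b ρ) (loopAt b τ)) (loopAt b (concat ρ τ)) := by
  -- The return to `x₀` and the departure along the same `b y` cancel.
  have h : GHomotopic (concat (reverse (b y)) (concat (b y) (concat τ (reverse (b z)))))
      (concat τ (reverse (b z))) := by
    rw [← concat_assoc]
    exact ((reverse_concat (b y)).concat (.refl _)).trans (refl_concat _)
  simp only [loopAt, concat_assoc]
  exact (GHomotopic.refl _).concat ((GHomotopic.refl _).concat h)

/-- The class of the `G`-loop `loopAt b ρ` in the abelianized fundamental group. -/
def loopValue {x₀ : M} (b : ∀ x, 𝒢.GPath x₀ x) {x y : M} (ρ : 𝒢.GPath x y) :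
    Additive (Abelianization (𝒢.FundamentalGroup x₀)) :=
  Additive.ofMul (Abelianization.of (homotopyClass (loopAt b ρ)))

section

variable {x₀ : M} (b : ∀ x, 𝒢.GPath x₀ x)

theorem GHomotopic.loopValue_eq {x y : M} {ρ ρ' : 𝒢.GPath x y} (h : GHomotopic ρ ρ') :
    loopValue b ρ = loopValue b ρ' :=
  congrArg (fun a => Additive.ofMul (Abelianization.of a))
    (Quotient.sound (((GHomotopic.refl _).concat h).concat (.refl _)) :
      homotopyClass (loopAt b ρ) = homotopyClass (loopAt b ρ'))

theorem loopValue_concat {x y z : M} (ρ : 𝒢.GPath x y) (τ : 𝒢.GPath y z) :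
    loopValue b (concat ρ τ) = loopValue b ρ + loopValue b τ := by
  have h : homotopyClass (loopAt b (concat ρ τ)) =
      homotopyClass (loopAt b ρ) * homotopyClass (loopAt b τ) :=
    (Quotient.sound (loopAt_concat b ρ τ)).symm
  rw [loopValue, h, map_mul]
  rfl

theorem loopValue_glue {x a c y : M} (σ : 𝒢.GPath x a) (g : 𝒢.Arrow a c) (τ : 𝒢.GPath c y) :
    loopValue b (glue σ g τ) = loopValue b σ + loopValue b (ofArrow g) + loopValue b τ := by
  rw [(glue_gHomotopic σ g τ).loopValue_eq, loopValue_concat, loopValue_concat]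

theorem loopValue_cons {x a c y : M} (γ : PSPath EM x a) (g : 𝒢.Arrow a c) (τ : 𝒢.GPath c y) :
    loopValue b (cons γ g τ) =
      loopValue b (single γ) + loopValue b (ofArrow g) + loopValue b τ :=
  loopValue_glue b (single γ) g τ

theorem loopValue_refl (x : M) : loopValue b (single (PSPath.refl x)) = 0 := by
  have h := (refl_concat (single (PSPath.refl x) : 𝒢.GPath x x)).loopValue_eq b
  rwa [loopValue_concat, add_eq_left] at h

theorem loopValue_single_trans {x y z : M} (γ : PSPath EM x y) (γ' : PSPath EM y z) :
    loopValue b (single (γ.trans γ')) = loopValue b (single γ) + loopValue b (single γ') := by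
  rw [← loopValue_concat]
  exact ((Step.concat_single γ γ').gHomotopic.loopValue_eq b).symm

theorem loopValue_ofArrow_trans {x y z : M} (g : 𝒢.Arrow x y) (h : 𝒢.Arrow y z) :
    loopValue b (ofArrow (g.trans h)) = loopValue b (ofArrow g) + loopValue b (ofArrow h) := by
  have h1 := (Step.mul (PSPath.refl x) g h (single (PSPath.refl z))).gHomotopic.loopValue_eq b
  rw [loopValue_cons, loopValue_refl, zero_add] at h1
  exact h1.symm

/-- For a loop at `x₀`, `loopAt b` conjugates by the loop `b x₀`, which need not be trivial;
abelianizing removes the conjugation. -/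
theorem loopValue_loop (σ : 𝒢.GPath x₀ x₀) :
    loopValue b σ = Additive.ofMul (Abelianization.of (homotopyClass σ)) := by
  have h : homotopyClass (loopAt b σ) =
      homotopyClass (b x₀) * homotopyClass σ * (homotopyClass (b x₀))⁻¹ := rfl
  rw [loopValue, h]
  refine congrArg Additive.ofMul ?_
  rw [map_mul, map_mul, map_inv, mul_inv_cancel_comm]

/-- A path `d` of arrows relates the arrows `d 0` and `d 1`. -/
theorem gHomotopic_of_arrow_path (d : C(unitInterval, G)) {σ : PSPath EM (𝒢.s (d 0)) (𝒢.s (d 1))}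
    {τ : PSPath EM (𝒢.t (d 0)) (𝒢.t (d 1))} {p : Path (𝒢.s (d 0)) (𝒢.s (d 1))}
    {q : Path (𝒢.t (d 0)) (𝒢.t (d 1))} (hp : ∀ r, p r = 𝒢.s (d r)) (hq : ∀ r, q r = 𝒢.t (d r))
    (H : p.Homotopy σ.1) (K : τ.1.Homotopy q) :
    GHomotopic (𝒢 := 𝒢) (cons (PSPath.refl _) ⟨d 0, rfl, rfl⟩ (single τ))
      (cons σ ⟨d 1, rfl, rfl⟩ (single (PSPath.refl _))) := by
  -- Three clocks, each running from 0 to 1 during its own third of the time. Under `e 0`, `K` turns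
  -- `τ` into `q`; under `e 1`, the arrow moves along `d`; under `e 2`, `H` turns `p` into `σ`.
  -- While the arrow moves, the paths are thus exactly `p` and `q`, which match its source and
  -- target.
  let e : ℝ → C(unitInterval, unitInterval) := fun k =>
    ⟨fun r => Set.projIcc 0 1 (zero_le_one' ℝ) (3 * (r : ℝ) - k), by fun_prop⟩
  have e0 : ∀ (k : ℝ) (r : unitInterval), 3 * (r : ℝ) ≤ k → e k r = 0 := fun k r h =>
    Set.projIcc_of_le_left (zero_le_one' ℝ) (by linarith)
  have e1 : ∀ (k : ℝ) (r : unitInterval), k + 1 ≤ 3 * (r : ℝ) → e k r = 1 := fun k r h =>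
    Set.projIcc_of_right_le (zero_le_one' ℝ) (by linarith)
  have a0 : e 0 0 = 0 := e0 _ _ (by simp)
  have b0 : e 1 0 = 0 := e0 _ _ (by simp)
  have b1 : e 1 1 = 1 := e1 _ _ (by norm_num)
  have c1 : e 2 1 = 1 := e1 _ _ (by norm_num)
  have hHs : ∀ u, H (u, 0) = 𝒢.s (d 0) := H.source
  have hKt : ∀ u, K (u, 1) = 𝒢.t (d 1) := K.target
  have hs : ∀ r, H (e 2 r, e 1 r) = 𝒢.s (d (e 1 r)) := by
    intro r
    rcases le_total (3 * (r : ℝ)) 2 with h | h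
    · rw [e0 2 r h, H.apply_zero]
      exact hp _
    · rw [e1 1 r (by linarith)]
      exact H.target _
  have ht : ∀ r, K (e 0 r, e 1 r) = 𝒢.t (d (e 1 r)) := by
    intro r
    rcases le_total (3 * (r : ℝ)) 1 with h | h
    · rw [e0 1 r h]
      exact K.source _
    · rw [e1 0 r (by linarith), K.apply_one]
      exact hq _
  -- The first path covers the source side up to the current position `e 1` of the arrow (hence
  -- `⊓`), the last path the target side from that position on (hence `⊔`).
  refine Deformation.gHomotopic (Deform.cons' _ (fun r => 𝒢.t (d (e 1 r)))
    ⟨fun u => H (e 2 u.1, e 1 u.1 ⊓ u.2), by fun_prop⟩ (d.comp (e 1)) (fun r => ?_)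
    (fun r => rfl) (fun r => ?_) (fun r => ?_) ?_ ?_ (fun r => ?_)
    (Deform.single' _ ⟨fun u => K (e 0 u.1, e 1 u.1 ⊔ u.2), by fun_prop⟩ (fun r => ?_)
      (fun r => ?_) (fun r => ?_) (fun r => ?_)))
  · change H (e 2 r, e 1 r ⊓ 0) = _
    rw [inf_eq_right.2 unitInterval.nonneg']
    exact hHs _
  · change H (e 2 0, e 1 0 ⊓ r) = 𝒢.s (d 0)
    rw [b0, inf_eq_left.2 unitInterval.nonneg']
    exact hHs _
  · change H (e 2 1, e 1 1 ⊓ r) = σ.1 r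
    rw [b1, c1, inf_eq_right.2 unitInterval.le_one']
    exact H.apply_one r
  · exact congrArg d b0
  · exact congrArg d b1
  · change 𝒢.s (d (e 1 r)) = H (e 2 r, e 1 r ⊓ 1)
    rw [inf_eq_left.2 unitInterval.le_one', hs]
  · change K (e 0 r, e 1 r ⊔ 0) = _
    rw [sup_eq_left.2 unitInterval.nonneg', ht]
  · change K (e 0 0, e 1 0 ⊔ r) = τ.1 r
    rw [a0, b0, sup_eq_right.2 unitInterval.nonneg']
    exact K.apply_zero r
  · change K (e 0 1, e 1 1 ⊔ r) = 𝒢.t (d 1)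
    rw [b1, sup_eq_left.2 unitInterval.le_one']
    exact hKt _
  · change K (e 0 r, e 1 r ⊔ 1) = _
    rw [sup_eq_right.2 unitInterval.le_one']
    exact hKt _

theorem loopValue_arrow_path (d : C(unitInterval, G)) {σ : PSPath EM (𝒢.s (d 0)) (𝒢.s (d 1))}
    {τ : PSPath EM (𝒢.t (d 0)) (𝒢.t (d 1))} {p : Path (𝒢.s (d 0)) (𝒢.s (d 1))}
    {q : Path (𝒢.t (d 0)) (𝒢.t (d 1))} (hp : ∀ r, p r = 𝒢.s (d r)) (hq : ∀ r, q r = 𝒢.t (d r))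
    (H : p.Homotopy σ.1) (K : τ.1.Homotopy q) :
    loopValue b (ofArrow (⟨d 0, rfl, rfl⟩ : 𝒢.Arrow _ _)) + loopValue b (single τ) =
      loopValue b (single σ) + loopValue b (ofArrow (⟨d 1, rfl, rfl⟩ : 𝒢.Arrow _ _)) := by
  have h := (gHomotopic_of_arrow_path (𝒢 := 𝒢) d hp hq H K).loopValue_eq b
  have h₀ := loopValue_cons b (PSPath.refl _) (⟨d 0, rfl, rfl⟩ : 𝒢.Arrow _ _) (single τ)
  have h₁ := loopValue_cons b σ (⟨d 1, rfl, rfl⟩ : 𝒢.Arrow _ _) (single (PSPath.refl _))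
  rw [loopValue_refl, zero_add] at h₀
  rw [loopValue_refl, add_zero] at h₁
  exact h₀.symm.trans (h.trans h₁)

end

end GPath

open GPath

/-! ### Evaluation of total 1-chains in the abelianized fundamental group -/

section Manifold

variable [IsManifold 𝓘(ℝ, EM) ∞ M]

variable (EM) in
/-- A piecewise smooth path homotopic to a given continuous path. -/
def smoothing (f : C(unitInterval, M)) : PSPath EM (f 0) (f 1) :=
  (isSmoothable (E := EM) (⟨f, rfl, rfl⟩ : Path (f 0) (f 1))).choose

variable (EM) in
theorem smoothing_spec (f : C(unitInterval, M)) :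
    (⟨f, rfl, rfl⟩ : Path (f 0) (f 1)).Homotopic (smoothing EM f).1 :=
  (isSmoothable (E := EM) (⟨f, rfl, rfl⟩ : Path (f 0) (f 1))).choose_spec

variable {x₀ : M} (b : ∀ x, 𝒢.GPath x₀ x)

/-- The class in the abelianized fundamental group assigned to a continuous path. -/
def edgeValue (f : C(unitInterval, M)) : Additive (Abelianization (𝒢.FundamentalGroup x₀)) :=
  loopValue b (single (smoothing EM f))

/-- Two smoothings of one path are homotopic through continuous paths, and such a homotopy already
is a `G`-deformation. Any convenient smoothing may therefore replace the chosen one. -/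
theorem edgeValue_eq {x y : M} {p : Path x y} {γ : PSPath EM x y} (h : p.Homotopic γ.1) :
    edgeValue b p.toContinuousMap = loopValue b (single γ) := by
  obtain ⟨f, rfl, rfl⟩ := p
  obtain ⟨F⟩ := (smoothing_spec EM f).symm.trans h
  exact (GHomotopic.single_of_homotopy F).loopValue_eq b

theorem edgeValue_trans {x y z : M} (p : Path x y) (q : Path y z) :
    edgeValue b (p.trans q).toContinuousMap =
      edgeValue b p.toContinuousMap + edgeValue b q.toContinuousMap := by
  obtain ⟨γ, hγ⟩ := isSmoothable (E := EM) p
  obtain ⟨γ', hγ'⟩ := isSmoothable (E := EM) q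
  rw [edgeValue_eq b hγ, edgeValue_eq b hγ', ← loopValue_single_trans]
  exact edgeValue_eq b (γ := γ.trans γ') (hγ.hcomp hγ')

theorem edgeValue_homotopic {x y : M} {p q : Path x y} (h : p.Homotopic q) :
    edgeValue b p.toContinuousMap = edgeValue b q.toContinuousMap := by
  obtain ⟨γ, hγ⟩ := isSmoothable (E := EM) q
  rw [edgeValue_eq b hγ, edgeValue_eq b (h.trans hγ)]

/-- The class in the abelianized fundamental group assigned to a simplex of total degree `1`. -/
def simplexValue : ∀ q n : ℕ, 𝒢.Simplex q n → Additive (Abelianization (𝒢.FundamentalGroup x₀))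
  | 1, 0, σ => edgeValue b (ContinuousMap.comp (show C(stdSimplex ℝ (Fin 2), M) from σ)
      ⟨stdSimplexHomeomorphUnitInterval.symm, stdSimplexHomeomorphUnitInterval.symm.continuous⟩)
  | 0, 1, σ => loopValue b (ofArrow ⟨(σ default).1 0, rfl, rfl⟩)
  -- Total degree 1 is exhausted by the two cases above, so this value plays no role there.
  | _, _, _ => 0

/-- The linear extension of `simplexValue`. -/
def chainValue : 𝒢.Chains →ₗ[ℤ] Additive (Abelianization (𝒢.FundamentalGroup x₀)) :=
  Finsupp.linearCombination ℤ fun s : 𝒢.BiSimplex => simplexValue b s.1 s.2.1 s.2.2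

theorem chainValue_edgeChain (f : C(unitInterval, M)) :
    chainValue b (𝒢.edgeChain f) = edgeValue b f := by
  rw [chainValue, edgeChain, Finsupp.linearCombination_single, one_smul]
  refine congrArg (edgeValue b) (ContinuousMap.ext fun r => ?_)
  exact congrArg f (stdSimplexHomeomorphUnitInterval.apply_symm_apply r)

theorem chainValue_arrowChain {x y : M} (g : 𝒢.Arrow x y) :
    chainValue b (𝒢.arrowChain g.1) = loopValue b (ofArrow g) := by
  obtain ⟨g, rfl, rfl⟩ := g
  rw [chainValue, arrowChain, Finsupp.linearCombination_single, one_smul]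
  rfl

theorem chainValue_chain {x y : M} (σ : 𝒢.GPath x y) : chainValue b σ.chain = loopValue b σ := by
  induction σ with
  | single γ =>
    rw [chain_single, chainValue_edgeChain, edgeValue_eq b (.refl γ.1)]
  | cons γ g ρ ih =>
    rw [chain_cons, map_add, map_add, ih, chainValue_edgeChain, chainValue_arrowChain,
      edgeValue_eq b (.refl γ.1), loopValue_cons]

theorem chainValue_totalDifferential_pair (g h : G) (hgh : 𝒢.s g = 𝒢.t h) :
    chainValue b (𝒢.totalDifferential (Finsupp.single ⟨0, 2, 𝒢.pairSimplex g h hgh⟩ 1)) = 0 := by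
  let k : 𝒢.Arrow (𝒢.s h) (𝒢.t h) := ⟨h, rfl, rfl⟩
  let l : 𝒢.Arrow (𝒢.t h) (𝒢.t g) := ⟨g, hgh, rfl⟩
  rw [totalDifferential_pair, map_add, map_sub]
  have h1 := chainValue_arrowChain b (k.trans l)
  rw [loopValue_ofArrow_trans, ← chainValue_arrowChain, ← chainValue_arrowChain] at h1
  change chainValue b (𝒢.arrowChain k.1) - chainValue b (𝒢.arrowChain (k.trans l).1) +
    chainValue b (𝒢.arrowChain l.1) = 0
  rw [h1]
  abel

/-- The smoothed source and target paths form, with the two end arrows, the square of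
`loopValue_arrow_path`. -/
theorem chainValue_totalDifferential_arrowEdge (d : C(unitInterval, G)) :
    chainValue b
      (𝒢.totalDifferential (Finsupp.single ⟨1, 1, 𝒢.arrowEdgeSimplex d⟩ 1)) = 0 := by
  let f : C(unitInterval, M) := ⟨fun r => 𝒢.s (d r), 𝒢.continuous_s.comp d.continuous⟩
  let f' : C(unitInterval, M) := ⟨fun r => 𝒢.t (d r), 𝒢.continuous_t.comp d.continuous⟩
  obtain ⟨H⟩ := smoothing_spec EM f
  obtain ⟨K⟩ := (smoothing_spec EM f').symm
  rw [totalDifferential_arrowEdge, map_add, map_sub, map_sub, chainValue_edgeChain,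
    chainValue_edgeChain, chainValue_arrowChain b ⟨d 0, rfl, rfl⟩,
    chainValue_arrowChain b ⟨d 1, rfl, rfl⟩]
  have h' : loopValue b (ofArrow (⟨d 0, rfl, rfl⟩ : 𝒢.Arrow _ _)) + edgeValue b f' =
      edgeValue b f + loopValue b (ofArrow (⟨d 1, rfl, rfl⟩ : 𝒢.Arrow _ _)) :=
    loopValue_arrow_path b d (fun _ => rfl) (fun _ => rfl) H K
  change edgeValue b f' - edgeValue b f - _ + _ = 0
  rw [sub_sub, ← h']
  abel

theorem chainValue_totalDifferential_triangle (T : 𝒢.Simplex 2 0) :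
    chainValue b (𝒢.totalDifferential (Finsupp.single ⟨2, 0, T⟩ 1)) = 0 := by
  let S : C(stdSimplex ℝ (Fin 3), M) := T
  let c : Fin 3 → C(unitInterval, stdSimplex ℝ (Fin 3)) := fun j => (simplexFace 1 j).comp
    ⟨stdSimplexHomeomorphUnitInterval.symm, stdSimplexHomeomorphUnitInterval.symm.continuous⟩
  have hv0 : stdSimplexHomeomorphUnitInterval.symm 0 = stdSimplex.vertex (S := ℝ) (0 : Fin 2) :=
    (Homeomorph.symm_apply_eq _).2 rfl
  have hv1 : stdSimplexHomeomorphUnitInterval.symm 1 = stdSimplex.vertex (S := ℝ) (1 : Fin 2) :=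
    (Homeomorph.symm_apply_eq _).2 rfl
  have hc0 : ∀ j, c j 0 = stdSimplex.vertex (j.succAbove 0) := fun j =>
    (congrArg (simplexFace 1 j) hv0).trans (stdSimplex.map_vertex (S := ℝ) j.succAbove 0)
  have hc1 : ∀ j, c j 1 = stdSimplex.vertex (j.succAbove 1) := fun j =>
    (congrArg (simplexFace 1 j) hv1).trans (stdSimplex.map_vertex (S := ℝ) j.succAbove 1)
  -- The edges 01, 12 and 02 are the faces opposite to 2, 0 and 1. As the simplex is contractible,
  -- going 0 to 1 to 2 is homotopic to going 0 to 2 directly, and `S` transports this to `M`.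
  let p : Path (stdSimplex.vertex (S := ℝ) (0 : Fin 3)) (stdSimplex.vertex 1) :=
    ⟨c 2, hc0 2, hc1 2⟩
  let q : Path (stdSimplex.vertex (S := ℝ) (1 : Fin 3)) (stdSimplex.vertex 2) :=
    ⟨c 0, hc0 0, hc1 0⟩
  let w : Path (stdSimplex.vertex (S := ℝ) (0 : Fin 3)) (stdSimplex.vertex 2) :=
    ⟨c 1, hc0 1, hc1 1⟩
  have : ContractibleSpace (stdSimplex ℝ (Fin 3)) :=
    (convex_stdSimplex ℝ (Fin 3)).contractibleSpace ⟨_, single_mem_stdSimplex ℝ 0⟩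
  have hw : ((p.trans q).map S.continuous).Homotopic (w.map S.continuous) :=
    (SimplyConnectedSpace.paths_homotopic (p.trans q) w).map S
  have h1 := edgeValue_homotopic b hw
  rw [Path.map_trans, edgeValue_trans] at h1
  have hT : ∀ j, (Finsupp.single ⟨1, 0, T.comp (simplexFace 1 j)⟩ 1 : 𝒢.Chains) =
      𝒢.edgeChain (S.comp (c j)) := fun j => by
    refine congrArg (fun σ : 𝒢.Simplex 1 0 => (Finsupp.single ⟨1, 0, σ⟩ 1 : 𝒢.Chains))
      (ContinuousMap.ext fun r => ?_)
    exact congrArg (fun r => S (simplexFace 1 j r))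
      (stdSimplexHomeomorphUnitInterval.symm_apply_apply r).symm
  rw [totalDifferential_triangle, hT, hT, hT, map_add, map_sub, chainValue_edgeChain,
    chainValue_edgeChain, chainValue_edgeChain]
  have h2 : edgeValue b (S.comp (c 2)) + edgeValue b (S.comp (c 0)) = edgeValue b (S.comp (c 1)) :=
    h1
  rw [← h2]
  abel

theorem chainValue_eq_zero {c : 𝒢.Chains} (hc : c ∈ 𝒢.totalBoundaries 1) :
    chainValue b c = 0 := by
  have h : 𝒢.totalChains 2 ≤ LinearMap.ker (chainValue b ∘ₗ 𝒢.totalDifferential) := by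
    rw [totalChains, Finsupp.supported_eq_span_single, Submodule.span_le]
    rintro _ ⟨⟨q, n, σ⟩, hs, rfl⟩
    change q + n = 2 at hs
    change chainValue b (𝒢.totalDifferential (Finsupp.single ⟨q, n, σ⟩ 1)) = 0
    have hqn : (q = 0 ∧ n = 2) ∨ (q = 1 ∧ n = 1) ∨ (q = 2 ∧ n = 0) := by omega
    rcases hqn with ⟨rfl, rfl⟩ | ⟨rfl, rfl⟩ | ⟨rfl, rfl⟩
    · obtain ⟨g, h, hgh, rfl⟩ := 𝒢.exists_eq_pairSimplex σ
      exact chainValue_totalDifferential_pair b g h hgh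
    · obtain ⟨d, rfl⟩ := 𝒢.exists_eq_arrowEdgeSimplex σ
      exact chainValue_totalDifferential_arrowEdge b d
    · exact chainValue_totalDifferential_triangle b σ
  obtain ⟨c, hc, rfl⟩ := hc
  exact h hc

end Manifold

/-! ### Every cycle is homologous to a loop -/

theorem loopClass_chain_mem {x₀ : M} (σ : 𝒢.GPath x₀ x₀) :
    loopClass σ = 0 ↔ σ.chain ∈ 𝒢.totalBoundaries 1 :=
  Submodule.Quotient.mk_eq_zero _

theorem GPath.chain_refl_mem (x : M) :
    (single (PSPath.refl x) : 𝒢.GPath x x).chain ∈ 𝒢.totalBoundaries 1 :=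
  𝒢.edgeChain_const_mem x

/-- Homotopy invariance applied to `reverse_concat` avoids comparing reversed paths and inverse
arrows piece by piece. -/
theorem GPath.chain_reverse_mem {x y : M} (σ : 𝒢.GPath x y) :
    σ.reverse.chain + σ.chain ∈ 𝒢.totalBoundaries 1 := by
  convert add_mem (sub_mem (reverse_concat σ).chain_sub_mem (chain_concat_mem σ.reverse σ))
    (GPath.chain_refl_mem y) using 1
  abel

/-- The chains which are homologous to the chain of a `G`-loop at `x₀`. -/
def loopChains (𝒢 : LieGroupoid EM EG M G) (x₀ : M) : AddSubgroup 𝒢.Chains where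
  carrier := {c | ∃ σ : 𝒢.GPath x₀ x₀, c - σ.chain ∈ 𝒢.totalBoundaries 1}
  zero_mem' := ⟨single (PSPath.refl x₀), by
    rw [zero_sub]; exact neg_mem (GPath.chain_refl_mem x₀)⟩
  add_mem' := by
    rintro c c' ⟨σ, hσ⟩ ⟨σ', hσ'⟩
    refine ⟨concat σ σ', ?_⟩
    convert sub_mem (add_mem hσ hσ') (chain_concat_mem σ σ') using 1
    abel
  neg_mem' := by
    rintro c ⟨σ, hσ⟩
    refine ⟨σ.reverse, ?_⟩
    convert neg_mem (add_mem hσ (GPath.chain_reverse_mem σ)) using 1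
    abel

variable {x₀ : M} (b : ∀ x, 𝒢.GPath x₀ x)

/-- The linear map which sends a point `x` to the chain of the chosen `G`-path from `x₀` to `x`. -/
def coneChain : 𝒢.Chains →ₗ[ℤ] 𝒢.Chains :=
  Finsupp.linearCombination ℤ fun s : 𝒢.BiSimplex => match s with
    | ⟨0, 0, σ⟩ => (b (show M from σ default)).chain
    | _ => 0

theorem coneChain_point (x : M) :
    coneChain b (Finsupp.single ⟨0, 0, pointSimplex x⟩ 1) = (b x).chain := by
  rw [coneChain, Finsupp.linearCombination_single, one_smul]
  rfl

/-- The cone over the differential adds the chain of `b x` and subtracts that of `b y`, which up to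
boundaries is the loop through `b x`, `ρ` and back along `b y`. -/
theorem add_cone_mem_loopChains {x y : M} (ρ : 𝒢.GPath x y) {c : 𝒢.Chains}
    (hc : c - ρ.chain ∈ 𝒢.totalBoundaries 1)
    (hd : 𝒢.totalDifferential c =
      Finsupp.single ⟨0, 0, pointSimplex x⟩ 1 - Finsupp.single ⟨0, 0, pointSimplex y⟩ 1) :
    c + coneChain b (𝒢.totalDifferential c) ∈ 𝒢.loopChains x₀ := by
  refine ⟨loopAt b ρ, ?_⟩
  rw [hd, map_sub, coneChain_point, coneChain_point]
  convert sub_mem (sub_mem (sub_mem hc (chain_concat_mem (concat (b x) ρ) (b y).reverse))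
    (chain_concat_mem (b x) ρ)) (GPath.chain_reverse_mem (b y)) using 1
  rw [loopAt]
  abel

/-- Every total `1`-cycle is homologous to the chain of a `G`-loop. -/
theorem mem_loopChains [IsManifold 𝓘(ℝ, EM) ∞ M] (b : ∀ x, 𝒢.GPath x₀ x)
    {c : 𝒢.Chains} (hc : c ∈ 𝒢.totalCycles 1) : c ∈ 𝒢.loopChains x₀ := by
  -- The map `c ↦ c + coneChain b (δ c)` is linear, so landing in `loopChains` can be checked on
  -- generators, although these are not cycles; on cycles the map is the identity.
  have h : 𝒢.totalChains 1 ≤ (AddSubgroup.toIntSubmodule (𝒢.loopChains x₀)).comap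
      (LinearMap.id + coneChain b ∘ₗ 𝒢.totalDifferential) := by
    rw [totalChains, Finsupp.supported_eq_span_single, Submodule.span_le]
    rintro _ ⟨⟨q, n, σ⟩, hs, rfl⟩
    change q + n = 1 at hs
    change Finsupp.single ⟨q, n, σ⟩ 1 +
      coneChain b (𝒢.totalDifferential (Finsupp.single ⟨q, n, σ⟩ 1)) ∈ 𝒢.loopChains x₀
    have hqn : (q = 0 ∧ n = 1) ∨ (q = 1 ∧ n = 0) := by omega
    rcases hqn with ⟨rfl, rfl⟩ | ⟨rfl, rfl⟩
    · obtain ⟨g, rfl⟩ := 𝒢.exists_eq_arrowSimplex σ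
      let k : 𝒢.Arrow (𝒢.s g) (𝒢.t g) := ⟨g, rfl, rfl⟩
      refine add_cone_mem_loopChains b (ofArrow k) ?_ (totalDifferential_arrow k)
      -- `ofArrow` differs from the bare arrow by two constant paths.
      convert neg_mem (add_mem (𝒢.edgeChain_const_mem (𝒢.s g))
        (𝒢.edgeChain_const_mem (𝒢.t g))) using 1
      change 𝒢.arrowChain g - (𝒢.edgeChain (ContinuousMap.const _ (𝒢.s g)) + 𝒢.arrowChain g +
        𝒢.edgeChain (ContinuousMap.const _ (𝒢.t g))) = _
      abel
    · obtain ⟨f, rfl⟩ := 𝒢.exists_eq_edgeSimplex σ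
      have h1 := 𝒢.edgeChain_homotopic_mem (smoothing_spec EM f)
      rw [← chain_single] at h1
      have h2 := totalDifferential_path (𝒢 := 𝒢) (⟨f, rfl, rfl⟩ : Path (f 0) (f 1))
      exact add_cone_mem_loopChains b _ h1 h2
  have h1 : c + coneChain b (𝒢.totalDifferential c) ∈ 𝒢.loopChains x₀ := h hc.1
  rwa [LinearMap.mem_ker.1 hc.2, map_zero, add_zero] at h1

/-! ### Bijectivity of the induced homomorphism -/

theorem hurewicz_injective [IsManifold 𝓘(ℝ, EM) ∞ M] (b : ∀ x, 𝒢.GPath x₀ x) :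
    Function.Injective (Abelianization.lift (𝒢.hurewicz x₀)) := by
  rw [injective_iff_map_eq_one]
  rintro ⟨⟨σ⟩⟩ hσ
  have h1 : loopClass σ = 0 := Multiplicative.ofAdd.injective hσ
  -- Evaluating the bounding chain of `σ` gives zero on one side and the class of `σ` on the other.
  have h2 := chainValue_eq_zero b ((loopClass_chain_mem σ).1 h1)
  rw [chainValue_chain, loopValue_loop] at h2
  exact Additive.ofMul.injective h2

theorem hurewicz_surjective [IsManifold 𝓘(ℝ, EM) ∞ M] (b : ∀ x, 𝒢.GPath x₀ x) :
    Function.Surjective (𝒢.hurewicz x₀) := by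
  intro z
  obtain ⟨⟨c, hc⟩, hz⟩ := Submodule.Quotient.mk_surjective _ z.toAdd
  obtain ⟨σ, hσ⟩ := mem_loopChains b hc
  refine ⟨homotopyClass σ, ?_⟩
  rw [hurewicz_homotopyClass]
  refine congrArg Multiplicative.ofAdd (Eq.trans ?_ hz)
  exact ((Submodule.Quotient.eq
    ((𝒢.totalBoundaries 1).comap (𝒢.totalCycles 1).subtype)).2 hσ).symm

end LieGroupoid

end

theorem mainTheorem2 {EM EG : Type*} {M G : Type u}
    [NormedAddCommGroup EM] [NormedSpace ℝ EM] [FiniteDimensional ℝ EM]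
    [NormedAddCommGroup EG] [NormedSpace ℝ EG] [FiniteDimensional ℝ EG]
    [TopologicalSpace M] [ChartedSpace EM M] [IsManifold 𝓘(ℝ, EM) ∞ M]
    [TopologicalSpace G] [ChartedSpace EG G] [IsManifold 𝓘(ℝ, EG) ∞ G]
    (𝒢 : LieGroupoid EM EG M G) (hG : 𝒢.IsGConnected) (x₀ : M) :
    ∃ h : 𝒢.FundamentalGroup x₀ →* Multiplicative (𝒢.TotalHomology 1),
      (∀ σ : 𝒢.GPath x₀ x₀,
        h (LieGroupoid.homotopyClass σ) = Multiplicative.ofAdd (LieGroupoid.loopClass σ)) ∧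
      Function.Bijective (Abelianization.lift h) := by
  -- `G`-connectedness enters through this choice of base `G`-paths.
  have b : ∀ x, 𝒢.GPath x₀ x := fun x => (hG x₀ x).some
  refine ⟨𝒢.hurewicz x₀, LieGroupoid.hurewicz_homotopyClass,
    LieGroupoid.hurewicz_injective b, fun z => ?_⟩
  obtain ⟨a, ha⟩ := LieGroupoid.hurewicz_surjective b z
  exact ⟨Abelianization.of a, (Abelianization.lift_apply_of _ a).trans ha⟩
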